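/- \textbf{Corollary (Dimension of the unstable manifold in a scalar DDE).} Let $a,b\in\mathbb R$ and $\tau\ge 0$, and consider the scalar delay differential equation $$\dot x(t)=a\,x(t)+b\,x(t-\tau).$$ Let $D_{\mathrm u}$ be the dimension of the unstable manifold of its equilibrium $0$, that is, of the linear subspace of all $\psi\in C([-\tau,0],\mathbb R)$ that are the restriction to $[-\tau,0]$ of a solution $x:\mathbb R\to\mathbb R$ with $x(t)\to 0$ as $t\to-\infty$. Let $\nu=1$ if $a+b>0$ and $\nu=0$ if $a+b<0$. Let $\arg z\in(0,2\pi]$ denote the minimal positive argument of $z\in\mathbb C\setminus\{0\}$. (i) If $|b|>|a|$, put $$\omega_H=\sqrt{b^2-a^2},\qquad \phi_H=\arg\overline{\left[\frac{i\omega_H-a}{b}\right]},$$ so that $\phi_H\in(0,2\pi)$ and $\phi_H\equiv-\arg\left[\frac{i\omega_H-a}{b}\right] \pmod{2\pi}$. Then $D_{\mathrm u}$ is finite and $$D_{\mathrm u}=2\left\lceil\frac{1}{2\pi}\left(\tau\omega_H-\phi_H\right)\right\rceil+\nu =2\left\lceil\frac{1}{2\pi}\left(\tau\sqrt{b^2-a^2}-\arg\left[-\frac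 ab-i\,\operatorname{sgn}(b)\sqrt{1-\left(\frac ab\right)^2}\right]\right)\right\rceil+\nu .$$ (ii) If $|b|<|a|$, then $D_{\mathrm u}=\nu$ (for every $\tau\ge 0$). In both cases the set of unstable characteristic roots, i.e. of the zeros $\lambda\in\mathbb C$ of $\lambda-a-be^{-\lambda\tau}$ with $\operatorname{Re}\lambda>0$, is finite, and $D_{\mathrm u}$ equals the number of these roots counted with multiplicity. -/

import Mathlib

/-- The minimal positive argument of `z`: the argument of `z` lying in `(0, 2π]`. -/
noncomputable def minPosArg (z : ℂ) : ℝ :=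
  toIocMod Real.two_pi_pos 0 (Complex.arg z)

namespace ScalarDDE

/-- `x : ℝ → ℝ` is an entire solution of `x'(t) = a x(t) + b x(t - τ)`, i.e. a solution for all
times `t ∈ ℝ`. -/
def IsEntireSolution (a b τ : ℝ) (x : ℝ → ℝ) : Prop :=
  ∀ t : ℝ, HasDerivAt x (a * x t + b * x (t - τ)) t

/-- The unstable manifold of the equilibrium `0` in the phase space `C([-τ, 0], ℝ)`: all states
through which there passes a complete orbit that tends to the equilibrium as `t → -∞`.
As the equation is linear, it is a linear subspace. -/
def unstableManifold (a b τ : ℝ) : Submodule ℝ C(Set.Icc (-τ) (0 : ℝ), ℝ) where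
  carrier := {ψ | ∃ x : ℝ → ℝ, IsEntireSolution a b τ x ∧
    Filter.Tendsto x Filter.atBot (nhds 0) ∧ ∀ θ : Set.Icc (-τ) (0 : ℝ), ψ θ = x θ}
  zero_mem' := by
    refine ⟨fun _ => 0, fun t => ?_, tendsto_const_nhds, fun θ => rfl⟩
    simpa using hasDerivAt_const t (0 : ℝ)
  add_mem' := by
    rintro ψ₁ ψ₂ ⟨x, hx, hx0, hxe⟩ ⟨y, hy, hy0, hye⟩
    refine ⟨fun t => x t + y t, fun t => ?_, by simpa using hx0.add hy0, fun θ => ?_⟩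
    · exact ((hx t).add (hy t)).congr_deriv (by ring)
    · simp [hxe, hye]
  smul_mem' := by
    rintro c ψ ⟨x, hx, hx0, hxe⟩
    refine ⟨fun t => c * x t, fun t => ?_, by simpa using hx0.const_mul c, fun θ => ?_⟩
    · exact ((hx t).const_mul c).congr_deriv (by ring)
    · simp [hxe]

/-- The characteristic function `χ(λ) = λ - a - b e^{-λτ}`. -/
noncomputable def charFn (a b τ : ℝ) (z : ℂ) : ℂ :=
  z - a - b * Complex.exp (-z * τ)

/-- The unstable characteristic roots: the zeros of `χ` with positive real part. -/
def unstableRoots (a b τ : ℝ) : Set ℂ :=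
  {z : ℂ | charFn a b τ z = 0 ∧ 0 < z.re}

/-- The number of unstable characteristic roots, counted with multiplicity
(meaningful when `unstableRoots a b τ` is finite). -/
noncomputable def numUnstableRoots (a b τ : ℝ) : ℕ :=
  ∑ᶠ z ∈ unstableRoots a b τ, analyticOrderNatAt (charFn a b τ) z

/-- The root `Y(ω) = (iω - a)/b` of the generating polynomial `iω - a - bY` (for `b ≠ 0`). -/
noncomputable def genRoot (a b ω : ℝ) : ℂ :=
  (Complex.I * ω - a) / b

/-- The crossing frequency `ω_H = √(b² - a²)`. -/
noncomputable def omegaH (a b : ℝ) : ℝ :=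
  √(b ^ 2 - a ^ 2)

/-- The phase `φ_H = -arg Y(ω_H)` modulo `2π`, normalised to `(0, 2π]`: the minimal positive
argument of the complex conjugate of `Y(ω_H)`. -/
noncomputable def phiH (a b : ℝ) : ℝ :=
  minPosArg (starRingEnd ℂ (genRoot a b (omegaH a b)))

/-- `ν = 1` for `a + b > 0` and `ν = 0` for `a + b < 0`; the case `a + b = 0` never occurs when
`|a| ≠ |b|`. -/
noncomputable def nu (a b : ℝ) : ℕ :=
  if 0 < a + b then 1 else 0

end ScalarDDE

/-! There are two independent halves: the dimension equals the number of unstable roots, and that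
number can be computed.

Dimension. Let D = d/dt act on the complex solutions that decay at -∞. The Laplace transform over
(-∞, 0] of such an x is -N/χ with N entire, and decay excludes poles with Re z ≤ 0. If there are no
poles at unstable roots either, N/χ continues to a bounded entire function that tends to 0 along the
positive axis; by Liouville it is 0, and x 0 = 0 (`eq_zero_of_laplaceQuot_order_nonneg`). Modulo χ,
D acts on N as multiplication by z. Hence p(D) = 0 for the polynomial p with the unstable roots as
zeros, with multiplicity (`aeval_derivEnd_eq_zero`). Eigenspaces of D have dimension at most 1, so
the dimension is at most deg p; the solutions e^{zt}, and t e^{zt} at double roots, give the reverse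
inequality. Restriction to the history interval is injective, and real and imaginary parts lead back
to real solutions.

Count. For τ > 0 put w = zτ, A = aτ, B = bτ, so that (w - A) e^w = B. With u = w - A, the number u
e^u is real, which in the upper half plane means arg u + im u = nπ. On each of these curves both re
u and |u e^u| decrease strictly in arg u, so a curve carries at most one root. When |A| < |B|,
comparison with the point re u = -A tells whether it is unstable (`rootArgs_nonempty_iff_lt`). The
sign of B fixes the parity of n, and counting the admissible n gives the ceiling. Real roots
contribute ν, except when the pair of branch 1 is replaced by two real roots, which leaves the total
unchanged (`scaledCount_of_abs_lt`). -/

namespace ScalarDDE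

open Filter Topology MeasureTheory Complex

variable {a b τ : ℝ}

/-! ### Complex solutions decaying at -∞ -/

/-- Complex-valued entire solutions of `x'(t) = a x(t) + b x(t - τ)` that tend to `0` at `-∞`. -/
def decayingSolutions (a b τ : ℝ) : Submodule ℂ (ℝ → ℂ) where
  carrier := {x | (∀ t : ℝ, HasDerivAt x (a * x t + b * x (t - τ)) t) ∧ Tendsto x atBot (𝓝 0)}
  zero_mem' := ⟨fun t => (hasDerivAt_const t (0 : ℂ)).congr_deriv (by simp), tendsto_const_nhds⟩
  add_mem' := by
    rintro x y ⟨hx, hx0⟩ ⟨hy, hy0⟩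
    refine ⟨fun t => ((hx t).add (hy t)).congr_deriv ?_, add_zero (0 : ℂ) ▸ hx0.add hy0⟩
    simp only [Pi.add_apply]; ring
  smul_mem' := by
    rintro c x ⟨hx, hx0⟩
    refine ⟨fun t => ((hx t).const_smul c).congr_deriv ?_, smul_zero (A := ℂ) c ▸ hx0.const_smul c⟩
    simp only [Pi.smul_apply, smul_eq_mul]; ring

lemma continuous_of_mem_decayingSolutions {x : ℝ → ℂ} (hx : x ∈ decayingSolutions a b τ) :
    Continuous x :=
  continuous_iff_continuousAt.2 fun t => (hx.1 t).continuousAt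

lemma comp_sub_mem_decayingSolutions {x : ℝ → ℂ} (hx : x ∈ decayingSolutions a b τ) (s : ℝ) :
    (fun t => x (t - s)) ∈ decayingSolutions a b τ := by
  refine ⟨fun t => ?_, hx.2.comp (tendsto_atBot_add_const_right _ (-s) tendsto_id)⟩
  have := (hx.1 (t - s)).comp_sub_const t s
  rwa [sub_right_comm] at this

/-- Differentiation on the space of decaying solutions. -/
noncomputable def derivEnd (a b τ : ℝ) : Module.End ℂ (decayingSolutions a b τ) where
  toFun x := ⟨(a : ℂ) • (x : ℝ → ℂ) + (b : ℂ) • fun t => (x : ℝ → ℂ) (t - τ),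
    add_mem (Submodule.smul_mem _ _ x.2)
      (Submodule.smul_mem _ _ (comp_sub_mem_decayingSolutions x.2 τ))⟩
  map_add' x y := by
    ext t; simp; ring
  map_smul' c x := by
    ext t; simp; ring

lemma derivEnd_apply (x : decayingSolutions a b τ) (t : ℝ) :
    (derivEnd a b τ x : ℝ → ℂ) t = a * (x : ℝ → ℂ) t + b * (x : ℝ → ℂ) (t - τ) := rfl

lemma hasDerivAt_derivEnd (x : decayingSolutions a b τ) (t : ℝ) :
    HasDerivAt (x : ℝ → ℂ) ((derivEnd a b τ x : ℝ → ℂ) t) t := x.2.1 t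

/-- Translation on the space of decaying solutions. -/
def shiftEnd (a b τ s : ℝ) : Module.End ℂ (decayingSolutions a b τ) where
  toFun x := ⟨fun t => (x : ℝ → ℂ) (t - s), comp_sub_mem_decayingSolutions x.2 s⟩
  map_add' _ _ := rfl
  map_smul' _ _ := rfl

lemma commute_shiftEnd_derivEnd (s : ℝ) : Commute (shiftEnd a b τ s) (derivEnd a b τ) := by
  refine LinearMap.ext fun x => Subtype.ext (funext fun t => ?_)
  change (a : ℂ) * (x : ℝ → ℂ) (t - s) + b * (x : ℝ → ℂ) (t - s - τ) =
    a * (x : ℝ → ℂ) (t - s) + b * (x : ℝ → ℂ) (t - τ - s)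
  rw [sub_right_comm]

/-! ### The Laplace transform and its meromorphic continuation -/

/-- The numerator of the Laplace transform of a solution: `χ(z) ∫_{-∞}^0 e^{-zt} x(t) dt` is the
negative of this entire function. -/
noncomputable def laplaceNum (b τ : ℝ) (x : ℝ → ℂ) (z : ℂ) : ℂ :=
  x 0 + b * ∫ s in (0 : ℝ)..τ, exp (-z * s) * x (s - τ)

lemma exists_norm_le_of_mem {x : ℝ → ℂ} (hx : x ∈ decayingSolutions a b τ) (c : ℝ) :
    ∃ M : ℝ, 0 < M ∧ ∀ t ≤ c, ‖x t‖ ≤ M := by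
  have hc := continuous_of_mem_decayingSolutions hx
  obtain ⟨T, hT⟩ := eventually_atBot.1 (hx.2.norm.eventually_le_const
    (show ‖(0 : ℂ)‖ < 1 by simp))
  obtain ⟨M, hM⟩ := (isCompact_Icc (a := T) (b := c)).exists_bound_of_continuousOn hc.continuousOn
  refine ⟨max M 1, by simp, fun t ht => ?_⟩
  rcases le_total t T with h | h
  · exact (hT t h).trans (le_max_right _ _)
  · exact (hM t ⟨h, ht⟩).trans (le_max_left _ _)

lemma norm_exp_neg_mul (z : ℂ) (t : ℝ) : ‖exp (-z * t)‖ = Real.exp (-z.re * t) := by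
  simp [norm_exp]

lemma differentiable_laplaceNum {x : ℝ → ℂ} (hx : Continuous x) :
    Differentiable ℂ (laplaceNum b τ x) := by
  intro z
  refine (differentiableAt_const _).add (DifferentiableAt.const_mul ?_ _)
  obtain ⟨M, hM⟩ := (isCompact_uIcc (a := (0 : ℝ)) (b := τ)).exists_bound_of_continuousOn
    (f := fun s : ℝ => x (s - τ)) (by fun_prop)
  have hM0 : 0 ≤ M := (norm_nonneg _).trans (hM 0 (by simp))
  refine (intervalIntegral.hasDerivAt_integral_of_dominated_loc_of_deriv_le
    (F' := fun (z : ℂ) (s : ℝ) => -s * exp (-z * s) * x (s - τ))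
    (bound := fun s => |τ| * Real.exp ((‖z‖ + 1) * |τ|) * M)
    (Metric.ball_mem_nhds z one_pos) ?_ ?_ ?_ ?_ ?_ ?_).2.differentiableAt
  · exact Eventually.of_forall fun w => (by fun_prop : Continuous fun s : ℝ =>
      exp (-w * s) * x (s - τ)).aestronglyMeasurable
  · exact (by fun_prop : Continuous fun s : ℝ => exp (-z * s) * x (s - τ)).intervalIntegrable _ _
  · exact (by fun_prop : Continuous fun s : ℝ =>
      -s * exp (-z * s) * x (s - τ)).aestronglyMeasurable
  · refine Eventually.of_forall fun s hs w hw => ?_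
    have hs' : |s| ≤ |τ| := by
      have := Set.abs_sub_left_of_mem_uIcc (Set.uIoc_subset_uIcc hs)
      simpa using this
    rw [norm_mul, norm_mul, norm_exp_neg_mul, norm_neg, norm_real, Real.norm_eq_abs]
    have hw' : ‖w‖ ≤ ‖z‖ + 1 := by
      have h1 := norm_sub_norm_le w z
      have h2 : ‖w - z‖ < 1 := by simpa [dist_eq_norm] using hw
      linarith
    have : -w.re * s ≤ (‖z‖ + 1) * |τ| := by
      refine (le_abs_self _).trans ?_
      rw [abs_mul, abs_neg]
      exact mul_le_mul ((abs_re_le_norm w).trans hw') hs' (abs_nonneg _) (by positivity)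
    gcongr
    exact hM s (Set.uIoc_subset_uIcc hs)
  · exact intervalIntegrable_const
  · refine Eventually.of_forall fun s _ w _ => ?_
    have h : HasDerivAt (fun w : ℂ => -w * (s : ℂ)) (-(s : ℂ)) w := by
      simpa using (hasDerivAt_id w).neg.mul_const (s : ℂ)
    refine (h.cexp.mul_const (x (s - τ))).congr_deriv (by ring)

lemma integrableOn_exp_mul_of_mem {x : ℝ → ℂ} (hx : x ∈ decayingSolutions a b τ) {z : ℂ}
    (hz : z.re < 0) (c : ℝ) : IntegrableOn (fun t : ℝ => exp (-z * t) * x t) (Set.Iic c) := by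
  have hc := continuous_of_mem_decayingSolutions hx
  obtain ⟨M, hM0, hM⟩ := exists_norm_le_of_mem hx c
  refine Integrable.mono' ((integrableOn_exp_mul_Iic (neg_pos.2 hz) c).mul_const M)
    (by fun_prop : Continuous fun t : ℝ => exp (-z * t) * x t).aestronglyMeasurable ?_
  refine (ae_restrict_iff' measurableSet_Iic).2 (Eventually.of_forall fun t ht => ?_)
  rw [norm_mul, norm_exp_neg_mul]
  exact mul_le_mul_of_nonneg_left (hM t ht) (Real.exp_pos _).le

/-- Integrating (e^{-zt} x)' over (-∞, 0] expresses x 0 through the transforms of x and of its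
delayed copy. Shifting the variable in the latter leaves a remainder over [-τ, 0], which is the
integral in `laplaceNum`. -/
lemma charFn_mul_laplace {x : ℝ → ℂ} (hx : x ∈ decayingSolutions a b τ) {z : ℂ}
    (hz : z.re < 0) :
    charFn a b τ z * ∫ t in Set.Iic (0 : ℝ), exp (-z * t) * x t = -laplaceNum b τ x z := by
  have hI := integrableOn_exp_mul_of_mem hx hz
  have hJ := integrableOn_exp_mul_of_mem (comp_sub_mem_decayingSolutions hx τ) hz 0
  have h1 : ∫ t in Set.Iic (0 : ℝ), (exp (-z * t) * x t * (a - z) +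
      exp (-z * t) * x (t - τ) * b) = x 0 := by
    have hlim : Tendsto (fun t : ℝ => exp (-z * t) * x t) atBot (𝓝 0) := by
      rw [tendsto_zero_iff_norm_tendsto_zero]
      refine squeeze_zero' (Eventually.of_forall fun t => norm_nonneg _) ?_
        (tendsto_zero_iff_norm_tendsto_zero.1 hx.2)
      filter_upwards [eventually_le_atBot 0] with t ht
      rw [norm_mul, norm_exp_neg_mul]
      refine mul_le_of_le_one_left (norm_nonneg _) (Real.exp_le_one_iff.2 ?_)
      nlinarith
    have := integral_Iic_of_hasDerivAt_of_tendsto' (a := (0 : ℝ)) (m := 0)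
      (f := fun t : ℝ => exp (-z * t) * x t)
      (f' := fun t : ℝ => exp (-z * t) * x t * (a - z) + exp (-z * t) * x (t - τ) * b)
      (fun t _ => ?_) ((hI 0).mul_const _ |>.add (hJ.mul_const _)) hlim
    · simpa using this
    · have h : HasDerivAt (fun t : ℝ => -z * (t : ℂ)) (-z) t := by
        simpa using (ofRealCLM.hasDerivAt (x := t)).const_mul (-z)
      refine (h.cexp.mul (hx.1 t)).congr_deriv (by ring)
  have h2 : ∫ t in Set.Iic (0 : ℝ), exp (-z * t) * x (t - τ) =
      exp (-z * τ) * ∫ t in Set.Iic (-τ), exp (-z * t) * x t := by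
    have := (measurePreserving_sub_right volume τ).setIntegral_preimage_emb
      (measurableEmbedding_subRight τ) (fun t : ℝ => exp (-z * τ) * (exp (-z * t) * x t))
      (Set.Iic (-τ))
    rw [← integral_const_mul, ← this]
    have hpre : (fun t : ℝ => t - τ) ⁻¹' Set.Iic (-τ) = Set.Iic 0 := by
      ext t; simp
    rw [hpre]
    refine integral_congr_ae (Eventually.of_forall fun t => ?_)
    simp only
    rw [← mul_assoc, ← Complex.exp_add]
    congr 2
    push_cast; ring
  have h3 : ∫ s in (0 : ℝ)..τ, exp (-z * s) * x (s - τ) = exp (-z * τ) *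
      ((∫ t in Set.Iic (0 : ℝ), exp (-z * t) * x t) -
        ∫ t in Set.Iic (-τ), exp (-z * t) * x t) := by
    rw [intervalIntegral.integral_Iic_sub_Iic (hI _) (hI _),
      ← intervalIntegral.integral_const_mul]
    have := intervalIntegral.integral_comp_sub_right (a := 0) (b := τ)
      (fun t : ℝ => exp (-z * τ) * (exp (-z * t) * x t)) τ
    rw [zero_sub, sub_self] at this
    rw [← this]
    refine intervalIntegral.integral_congr fun t _ => ?_
    rw [← mul_assoc, ← Complex.exp_add]
    congr 2
    push_cast; ring
  rw [integral_add ((hI 0).mul_const _) (hJ.mul_const _), integral_mul_const,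
    integral_mul_const, h2] at h1
  rw [laplaceNum, h3, charFn, ← h1]
  ring

lemma differentiable_charFn (a b τ : ℝ) : Differentiable ℂ (charFn a b τ) := by
  unfold charFn; fun_prop

/-- The meromorphic continuation of (minus) the Laplace transform of a decaying solution. -/
noncomputable def laplaceQuot (a b τ : ℝ) (x : ℝ → ℂ) (z : ℂ) : ℂ :=
  laplaceNum b τ x z / charFn a b τ z

lemma meromorphicAt_laplaceQuot {x : ℝ → ℂ} (hx : x ∈ decayingSolutions a b τ) (z : ℂ) :
    MeromorphicAt (laplaceQuot a b τ x) z :=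
  ((differentiable_laplaceNum (continuous_of_mem_decayingSolutions hx)).analyticAt
    z).meromorphicAt.div ((differentiable_charFn a b τ).analyticAt z).meromorphicAt

/-- Only an inequality, because at zeros of χ the quotient has the default value 0. -/
lemma norm_laplaceQuot_le {x : ℝ → ℂ} (hx : x ∈ decayingSolutions a b τ) {z : ℂ}
    (hz : z.re < 0) :
    ‖laplaceQuot a b τ x z‖ ≤ ‖∫ t in Set.Iic (0 : ℝ), exp (-z * t) * x t‖ := by
  rcases eq_or_ne (charFn a b τ z) 0 with h | h
  · simp [laplaceQuot, h]
  · rw [laplaceQuot, ← neg_neg (laplaceNum b τ x z), ← charFn_mul_laplace hx hz, neg_div,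
      mul_div_cancel_left₀ _ h, norm_neg]

/-- Where ‖x‖ ≤ ε the integral is at most ε ∫ e^{rt} = ε/r; the rest of the half-line is compact and
contributes a bound independent of r. Mere boundedness of x would not give the limit 0. -/
lemma tendsto_mul_laplace {x : ℝ → ℂ} (hx : x ∈ decayingSolutions a b τ) {z : ℂ}
    (hz : z.re ≤ 0) :
    Tendsto (fun r : ℝ => r * ‖∫ t in Set.Iic (0 : ℝ), exp (-(z - r) * t) * x t‖)
      (𝓝[>] 0) (𝓝 0) := by
  obtain ⟨M, hM0, hM⟩ := exists_norm_le_of_mem hx 0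
  have key : ∀ ε : ℝ, 0 < ε → ∃ C : ℝ, ∀ r : ℝ, 0 < r →
      r * ‖∫ t in Set.Iic (0 : ℝ), exp (-(z - r) * t) * x t‖ ≤ ε + r * C := by
    intro ε hε
    obtain ⟨T, hT⟩ := eventually_atBot.1 (hx.2.norm.eventually_le_const
      (show ‖(0 : ℂ)‖ < ε by simpa))
    refine ⟨M * Real.exp (-T), fun r hr => ?_⟩
    have h1 := (integrableOn_exp_mul_Iic hr 0).const_mul ε
    have h2 := (integrableOn_exp_mul_Iic one_pos 0).const_mul (M * Real.exp (-T))
    have : ‖∫ t in Set.Iic (0 : ℝ), exp (-(z - r) * t) * x t‖ ≤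
        ∫ t in Set.Iic (0 : ℝ), (ε * Real.exp (r * t) +
          M * Real.exp (-T) * Real.exp (1 * t)) := by
      refine norm_integral_le_of_norm_le (h1.add h2) ?_
      refine (ae_restrict_iff' measurableSet_Iic).2 (Eventually.of_forall fun t ht => ?_)
      have ht0 : t ≤ 0 := ht
      rw [norm_mul, norm_exp_neg_mul]
      have hr1 : -(z - r).re * t ≤ r * t := by simp; nlinarith
      have hr2 : -(z - r).re * t ≤ 0 := hr1.trans (by nlinarith)
      rcases le_total t T with h | h
      · refine le_add_of_le_of_nonneg ?_ (by positivity)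
        rw [mul_comm]
        exact mul_le_mul (hT t h) (Real.exp_le_exp.2 hr1) (Real.exp_pos _).le hε.le
      · refine le_add_of_nonneg_of_le (by positivity) ?_
        rw [mul_assoc, ← Real.exp_add, mul_comm]
        refine mul_le_mul (hM t ht0) ?_ (Real.exp_pos _).le hM0.le
        exact Real.exp_le_exp.2 (by linarith)
    rw [integral_add h1 h2, integral_const_mul, integral_const_mul, integral_exp_mul_Iic hr,
      integral_exp_mul_Iic one_pos] at this
    calc _ ≤ r * _ := mul_le_mul_of_nonneg_left this hr.le
      _ = _ := by simp; field_simp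
  refine tendsto_order.2 ⟨fun c hc => ?_, fun ε hε => ?_⟩
  · filter_upwards [self_mem_nhdsWithin] with r hr
    exact hc.trans_le (mul_nonneg (le_of_lt hr) (norm_nonneg _))
  · obtain ⟨C, hC⟩ := key (ε / 2) (by positivity)
    have hlim : Tendsto (fun r : ℝ => ε / 2 + r * C) (𝓝[>] 0) (𝓝 (ε / 2 + 0 * C)) :=
      (Continuous.tendsto (by fun_prop) 0).mono_left nhdsWithin_le_nhds
    filter_upwards [self_mem_nhdsWithin, hlim.eventually_lt_const (u := ε) (by linarith)]
      with r hr h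
    exact (hC r hr).trans_lt h

/-- At a pole z the function (w - z) Q(w) has order at most 0 and cannot tend to 0, yet it does
along w = z - r by `tendsto_mul_laplace`. This is where purely imaginary roots are ruled out. -/
lemma laplaceQuot_order_nonneg_of_re_nonpos {x : ℝ → ℂ} (hx : x ∈ decayingSolutions a b τ)
    {z : ℂ} (hz : z.re ≤ 0) : 0 ≤ meromorphicOrderAt (laplaceQuot a b τ x) z := by
  by_contra! hneg
  have hf := meromorphicAt_laplaceQuot hx z
  have hid : MeromorphicAt (fun w : ℂ => w - z) z := by fun_prop
  have hpath : Tendsto (fun r : ℝ => z - r) (𝓝[>] 0) (𝓝[≠] z) := by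
    refine tendsto_nhdsWithin_iff.2 ⟨?_, ?_⟩
    · have : Tendsto (fun r : ℝ => z - r) (𝓝 0) (𝓝 (z - (0 : ℝ))) :=
        Continuous.tendsto (by fun_prop) 0
      simpa using this.mono_left nhdsWithin_le_nhds
    · filter_upwards [self_mem_nhdsWithin] with r (hr : 0 < r)
      simpa using hr.ne'
  have hzero : Tendsto (fun r : ℝ => ‖((fun w : ℂ => w - z) * laplaceQuot a b τ x) (z - r)‖)
      (𝓝[>] 0) (𝓝 0) := by
    refine squeeze_zero' (Eventually.of_forall fun _ => norm_nonneg _) ?_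
      (tendsto_mul_laplace hx hz)
    filter_upwards [self_mem_nhdsWithin] with r (hr : 0 < r)
    have : ‖z - r - z‖ = r := by
      rw [sub_sub_cancel_left, norm_neg, norm_real, Real.norm_of_nonneg hr.le]
    rw [Pi.mul_apply, norm_mul, this]
    refine mul_le_mul_of_nonneg_left (norm_laplaceQuot_le hx ?_) hr.le
    simp; linarith
  have hord1 : meromorphicOrderAt (fun w : ℂ => w - z) z = 1 := meromorphicOrderAt_id_sub_const
  have hord : meromorphicOrderAt ((fun w : ℂ => w - z) * laplaceQuot a b τ x) z ≤ 0 := by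
    rw [meromorphicOrderAt_mul hid hf, hord1]
    cases h : meromorphicOrderAt (laplaceQuot a b τ x) z with
    | top => simp [h] at hneg
    | coe n =>
      rw [h] at hneg
      norm_cast at hneg ⊢
      omega
  rcases hord.lt_or_eq with h | h
  · have := (tendsto_norm_cobounded_atTop.comp (tendsto_cobounded_of_meromorphicOrderAt_neg h)).comp
      hpath
    exact not_tendsto_nhds_of_tendsto_atTop this _ hzero
  · obtain ⟨c, hc0, hc⟩ := tendsto_ne_zero_of_meromorphicOrderAt_eq_zero (hid.mul hf) h
    exact hc0 (norm_eq_zero.1 (tendsto_nhds_unique (hc.norm.comp hpath) hzero))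

lemma norm_exp_neg_mul_ofReal_le {z : ℂ} {c s : ℝ} (hz : -c ≤ z.re) (hc : 0 ≤ c) (hs : 0 ≤ s)
    (hsτ : s ≤ τ) : ‖exp (-z * s)‖ ≤ Real.exp (c * τ) := by
  rw [norm_exp_neg_mul]
  refine Real.exp_le_exp.2 ?_
  nlinarith

lemma exists_norm_laplaceNum_le (hτ : 0 ≤ τ) {x : ℝ → ℂ} (hx : x ∈ decayingSolutions a b τ)
    {c : ℝ} (hc : 0 ≤ c) : ∃ C : ℝ, ∀ z : ℂ, -c ≤ z.re → ‖laplaceNum b τ x z‖ ≤ C := by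
  obtain ⟨M, hM0, hM⟩ := exists_norm_le_of_mem hx 0
  refine ⟨‖x 0‖ + |b| * (Real.exp (c * τ) * M * |τ - 0|), fun z hz => ?_⟩
  refine (norm_add_le _ _).trans ?_
  rw [norm_mul, norm_real, Real.norm_eq_abs]
  gcongr
  refine intervalIntegral.norm_integral_le_of_norm_le_const fun s hs => ?_
  rw [Set.uIoc_of_le hτ] at hs
  rw [norm_mul]
  gcongr
  · exact norm_exp_neg_mul_ofReal_le hz hc hs.1.le hs.2
  · exact hM _ (by linarith [hs.2])

lemma le_norm_charFn (hτ : 0 ≤ τ) {c : ℝ} (hc : 0 ≤ c) {z : ℂ} (hz : -c ≤ z.re) :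
    ‖z‖ - (|a| + |b| * Real.exp (c * τ)) ≤ ‖charFn a b τ z‖ := by
  have h1 : ‖(a : ℂ) + b * exp (-z * τ)‖ ≤ |a| + |b| * Real.exp (c * τ) := by
    refine (norm_add_le _ _).trans ?_
    rw [norm_mul, norm_real, norm_real, Real.norm_eq_abs, Real.norm_eq_abs]
    gcongr
    exact norm_exp_neg_mul_ofReal_le hz hc hτ le_rfl
  have h2 := norm_sub_norm_le z ((a : ℂ) + b * exp (-z * τ))
  rw [← sub_sub] at h2
  unfold charFn
  linarith

lemma tendsto_laplaceNum {x : ℝ → ℂ} (hτ : 0 ≤ τ) (hx : x ∈ decayingSolutions a b τ) :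
    Tendsto (fun r : ℝ => laplaceNum b τ x r) atTop (𝓝 (x 0)) := by
  obtain ⟨M, hM0, hM⟩ := exists_norm_le_of_mem hx 0
  have hc := continuous_of_mem_decayingSolutions hx
  have h : Tendsto (fun r : ℝ => ∫ s in (0 : ℝ)..τ, exp (-(r : ℂ) * s) * x (s - τ)) atTop
      (𝓝 (∫ s in (0 : ℝ)..τ, (0 : ℂ))) := by
    refine intervalIntegral.tendsto_integral_filter_of_dominated_convergence (fun _ => M)
      ?_ ?_ intervalIntegrable_const ?_
    · exact Eventually.of_forall fun r => (by fun_prop : Continuous fun s : ℝ =>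
        exp (-(r : ℂ) * s) * x (s - τ)).aestronglyMeasurable
    · filter_upwards [eventually_ge_atTop 0] with r hr
      refine Eventually.of_forall fun s hs => ?_
      rw [Set.uIoc_of_le hτ] at hs
      rw [norm_mul, ← one_mul M]
      refine mul_le_mul ?_ (hM _ (by linarith [hs.2])) (norm_nonneg _) zero_le_one
      simpa using norm_exp_neg_mul_ofReal_le (τ := τ) (z := r) (c := 0) (by simpa) le_rfl hs.1.le hs.2
    · refine Eventually.of_forall fun s hs => ?_
      rw [Set.uIoc_of_le hτ] at hs
      rw [← zero_mul (x (s - τ))]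
      refine Tendsto.mul_const _ (tendsto_zero_iff_norm_tendsto_zero.2 ?_)
      simp only [norm_exp_neg_mul, ofReal_re]
      refine Real.tendsto_exp_atBot.comp ?_
      simp only [neg_mul]
      exact tendsto_neg_atTop_atBot.comp (tendsto_id.atTop_mul_const hs.1)
  simpa [laplaceNum] using (h.const_mul (b : ℂ)).const_add (x 0)

/-- A decaying solution whose Laplace transform continues to an entire function vanishes
at `0`. -/
theorem eq_zero_of_laplaceQuot_order_nonneg (hτ : 0 ≤ τ) {x : ℝ → ℂ}
    (hx : x ∈ decayingSolutions a b τ)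
    (h : ∀ z : ℂ, 0 < z.re → 0 ≤ meromorphicOrderAt (laplaceQuot a b τ x) z) : x 0 = 0 := by
  have hmer : MeromorphicOn (laplaceQuot a b τ x) Set.univ :=
    fun z _ => meromorphicAt_laplaceQuot hx z
  set G := toMeromorphicNFOn (laplaceQuot a b τ x) Set.univ with hG
  have hGf : ∀ z, G =ᶠ[𝓝[≠] z] laplaceQuot a b τ x := fun z =>
    hmer.toMeromorphicNFOn_eq_self_on_nhdsNE (Set.mem_univ z)
  have hGd : Differentiable ℂ G := fun z => by
    refine AnalyticAt.differentiableAt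
      ((meromorphicNFOn_toMeromorphicNFOn _ _ (Set.mem_univ
        z)).meromorphicOrderAt_nonneg_iff_analyticAt.1 ?_)
    rw [meromorphicOrderAt_toMeromorphicNFOn hmer (Set.mem_univ z)]
    rcases le_or_gt z.re 0 with hz | hz
    · exact laplaceQuot_order_nonneg_of_re_nonpos hx hz
    · exact h z hz
  have hGc : ∀ z, Tendsto G (𝓝[≠] z) (𝓝 (G z)) := fun z =>
    hGd.continuous.continuousAt.mono_left nhdsWithin_le_nhds
  -- G agrees with the quotient only on punctured neighbourhoods, so bounds pass to G as limits;
  -- this needs U open.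
  have transfer : ∀ (U : Set ℂ) (C : ℝ), IsOpen U → (∀ z ∈ U, ‖laplaceQuot a b τ x z‖ ≤ C) →
      ∀ z ∈ U, ‖G z‖ ≤ C := by
    intro U C hU hC z hz
    refine le_of_tendsto (hGc z).norm ?_
    filter_upwards [hGf z, nhdsWithin_le_nhds (hU.mem_nhds hz)] with w hw hwU
    rw [hw]
    exact hC w hwU
  obtain ⟨C, hC⟩ := exists_norm_laplaceNum_le hτ hx (c := 2) (by norm_num)
  have hC0 : 0 ≤ C := (norm_nonneg _).trans (hC 0 (by simp))
  set K := |a| + |b| * Real.exp (2 * τ)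
  have hfar : ∀ z : ℂ, -2 ≤ z.re → K < ‖z‖ →
      ‖laplaceQuot a b τ x z‖ ≤ C / (‖z‖ - K) := by
    intro z hz hzK
    have := le_norm_charFn (a := a) (b := b) hτ (c := 2) (by norm_num) hz
    rw [laplaceQuot, norm_div]
    exact div_le_div₀ hC0 (hC z hz) (by linarith) this
  obtain ⟨M, hM0, hM⟩ := exists_norm_le_of_mem hx 0
  -- The half-planes Re z < -1 and Re z > -2 overlap, so open regions suffice. On the left the
  -- Laplace integral is bounded; on the right N is bounded and χ grows like z.
  have hleft : ∀ z : ℂ, z.re < -1 → ‖G z‖ ≤ M := by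
    refine transfer {z : ℂ | z.re < -1} M (isOpen_lt continuous_re continuous_const) ?_
    intro z (hz : z.re < -1)
    refine (norm_laplaceQuot_le hx (by linarith)).trans ?_
    have hI := (integrableOn_exp_mul_Iic (a := -z.re) (by linarith) 0).mul_const M
    refine (norm_integral_le_of_norm_le hI ?_).trans ?_
    · refine (ae_restrict_iff' measurableSet_Iic).2 (Eventually.of_forall fun t ht => ?_)
      rw [norm_mul, norm_exp_neg_mul]
      exact mul_le_mul_of_nonneg_left (hM t ht) (Real.exp_pos _).le
    · rw [integral_mul_const, integral_exp_mul_Iic (by linarith), mul_zero, Real.exp_zero]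
      refine mul_le_of_le_one_left hM0.le ?_
      rw [div_le_one (by linarith)]
      linarith
  have hright : ∀ z : ℂ, -2 < z.re → K + 1 < ‖z‖ → ‖G z‖ ≤ C := by
    intro z h1 h2
    refine transfer ({z : ℂ | -2 < z.re} ∩ {z | K + 1 < ‖z‖}) C
      ((isOpen_lt continuous_const continuous_re).inter
        (isOpen_lt continuous_const continuous_norm)) ?_ z ⟨h1, h2⟩
    rintro w ⟨hw1, hw2⟩
    simp only [Set.mem_ofPred_eq] at hw1 hw2
    refine (hfar w hw1.le (by linarith)).trans (div_le_self hC0 (by linarith))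
  obtain ⟨B, hB⟩ := (isCompact_closedBall (0 : ℂ) (K + 1)).exists_bound_of_continuousOn
    hGd.continuous.continuousOn
  have hbdd : Bornology.IsBounded (Set.range G) := by
    refine isBounded_iff_forall_norm_le.2 ⟨max M (max C B), ?_⟩
    rintro _ ⟨z, rfl⟩
    rcases lt_or_ge z.re (-1) with h1 | h1
    · exact (hleft z h1).trans (le_max_left _ _)
    rcases lt_or_ge (K + 1) ‖z‖ with h2 | h2
    · exact (hright z (by linarith) h2).trans ((le_max_left _ _).trans (le_max_right _ _))
    · exact (hB z (by simpa using h2)).trans ((le_max_right _ _).trans (le_max_right _ _))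
  have hconst := hGd.apply_eq_apply_of_bounded hbdd
  have hdom : ∀ᶠ r : ℝ in atTop, ‖G 0‖ ≤ C / (r - K) := by
    filter_upwards [eventually_gt_atTop (max 0 K)] with r hr
    have hr0 : 0 < r := (le_max_left _ _).trans_lt hr
    have hrK : K < r := (le_max_right _ _).trans_lt hr
    rw [hconst 0 r]
    have hc : ContinuousAt (fun w : ℂ => C / (‖w‖ - K)) r := by
      refine ContinuousAt.div (by fun_prop) (by fun_prop) ?_
      rw [norm_real, Real.norm_of_nonneg hr0.le]
      linarith
    have hlim := hc.tendsto.mono_left (nhdsWithin_le_nhds (s := {(r : ℂ)}ᶜ))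
    rw [norm_real, Real.norm_of_nonneg hr0.le] at hlim
    refine le_of_tendsto_of_tendsto (hGc r).norm hlim ?_
    have hU : {z : ℂ | -2 < z.re} ∩ {z | K < ‖z‖} ∈ 𝓝 (r : ℂ) := by
      refine ((isOpen_lt continuous_const continuous_re).inter
        (isOpen_lt continuous_const continuous_norm)).mem_nhds ⟨?_, ?_⟩
      · simp; linarith
      · simpa [abs_of_pos hr0] using hrK
    filter_upwards [hGf r, nhdsWithin_le_nhds hU] with w hw hwU
    rw [hw]
    exact hfar w (le_of_lt hwU.1) hwU.2
  have hG0 : G 0 = 0 := by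
    have hlim : Tendsto (fun r : ℝ => C / (r - K)) atTop (𝓝 0) :=
      tendsto_const_nhds.div_atTop (tendsto_atTop_add_const_right _ (-K) tendsto_id)
    exact norm_le_zero_iff.1 (ge_of_tendsto hlim hdom)
  -- For large real r, χ(r) ≠ 0, so G = 0 gives N(r) = 0, while N(r) → x 0.
  refine tendsto_nhds_unique (tendsto_laplaceNum hτ hx) (Tendsto.congr' ?_ tendsto_const_nhds)
  filter_upwards [eventually_gt_atTop (max 0 K)] with r hr
  have hr0 : 0 < r := (le_max_left _ _).trans_lt hr
  have hrK : K < r := (le_max_right _ _).trans_lt hr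
  have hne : charFn a b τ r ≠ 0 := by
    have := le_norm_charFn (a := a) (b := b) hτ (c := 2) (by norm_num) (z := r) (by simp; linarith)
    rw [norm_real, Real.norm_of_nonneg hr0.le] at this
    exact norm_pos_iff.1 (by linarith)
  have hcont : ContinuousAt (laplaceQuot a b τ x) r :=
    (differentiable_laplaceNum (continuous_of_mem_decayingSolutions hx)).continuous.continuousAt.div
      (differentiable_charFn a b τ).continuous.continuousAt hne
  have heq : G r = laplaceQuot a b τ x r :=
    tendsto_nhds_unique_of_eventuallyEq (hGc r) (hcont.tendsto.mono_left nhdsWithin_le_nhds) (hGf r)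
  rw [hconst r 0, hG0, laplaceQuot, eq_comm, div_eq_zero_iff] at heq
  exact (heq.resolve_right hne).symm

/-! ### Polynomials in d/dt acting on decaying solutions -/

lemma laplaceNum_derivEnd (x : decayingSolutions a b τ) (z : ℂ) :
    laplaceNum b τ (derivEnd a b τ x) z =
      z * laplaceNum b τ x z - charFn a b τ z * (x : ℝ → ℂ) 0 := by
  have hc := continuous_of_mem_decayingSolutions x.2
  have hc' := continuous_of_mem_decayingSolutions (derivEnd a b τ x).2
  have hd : ∀ s : ℝ, HasDerivAt (fun s : ℝ => exp (-z * s) * (x : ℝ → ℂ) (s - τ))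
      (-z * (exp (-z * s) * (x : ℝ → ℂ) (s - τ)) +
        exp (-z * s) * (derivEnd a b τ x : ℝ → ℂ) (s - τ)) s := by
    intro s
    have h : HasDerivAt (fun t : ℝ => -z * (t : ℂ)) (-z) s := by
      simpa using (ofRealCLM.hasDerivAt (x := s)).const_mul (-z)
    have hx := (hasDerivAt_derivEnd x (s - τ)).comp_sub_const s τ
    refine (h.cexp.mul hx).congr_deriv (by ring)
  have h1 : Continuous fun s : ℝ => -z * (exp (-z * s) * (x : ℝ → ℂ) (s - τ)) := by fun_prop
  have h2 : Continuous fun s : ℝ => exp (-z * s) * (derivEnd a b τ x : ℝ → ℂ) (s - τ) := by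
    fun_prop
  have key := intervalIntegral.integral_eq_sub_of_hasDerivAt (a := 0) (b := τ)
    (fun s _ => hd s) ((h1.add h2).intervalIntegrable _ _)
  rw [intervalIntegral.integral_add (h1.intervalIntegrable _ _) (h2.intervalIntegrable _ _),
    intervalIntegral.integral_const_mul] at key
  have key' := eq_sub_of_add_eq' key
  rw [laplaceNum, laplaceNum, key', derivEnd_apply, charFn]
  simp
  ring

lemma laplaceNum_add {x y : ℝ → ℂ} (hx : Continuous x) (hy : Continuous y) (z : ℂ) :
    laplaceNum b τ (x + y) z = laplaceNum b τ x z + laplaceNum b τ y z := by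
  have h1 : Continuous fun s : ℝ => exp (-z * s) * x (s - τ) := by fun_prop
  have h2 : Continuous fun s : ℝ => exp (-z * s) * y (s - τ) := by fun_prop
  simp only [laplaceNum, Pi.add_apply, mul_add]
  rw [intervalIntegral.integral_add (h1.intervalIntegrable _ _) (h2.intervalIntegrable _ _)]
  ring

lemma laplaceNum_smul (c : ℂ) (x : ℝ → ℂ) (z : ℂ) :
    laplaceNum b τ (c • x) z = c * laplaceNum b τ x z := by
  simp only [laplaceNum, Pi.smul_apply, smul_eq_mul, mul_left_comm _ c]
  rw [intervalIntegral.integral_const_mul]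
  ring

-- By iterating `laplaceNum_derivEnd`: each derivative multiplies the numerator by z, up to χ times
-- an entire function.
open Polynomial in
lemma exists_laplaceNum_aeval (p : ℂ[X]) (x : decayingSolutions a b τ) :
    ∃ q : ℂ → ℂ, Differentiable ℂ q ∧ ∀ z, laplaceNum b τ (aeval (derivEnd a b τ) p x) z =
      p.eval z * laplaceNum b τ x z + charFn a b τ z * q z := by
  induction p using Polynomial.induction_on generalizing x with
  | C c =>
    refine ⟨0, differentiable_const _, fun z => ?_⟩
    have : (aeval (derivEnd a b τ) (C c) x : ℝ → ℂ) = c • (x : ℝ → ℂ) := by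
      rw [aeval_C, Module.algebraMap_end_apply]; rfl
    rw [this, laplaceNum_smul]
    simp
  | add p₁ p₂ h₁ h₂ =>
    obtain ⟨q₁, hq₁, e₁⟩ := h₁ x
    obtain ⟨q₂, hq₂, e₂⟩ := h₂ x
    refine ⟨q₁ + q₂, hq₁.add hq₂, fun z => ?_⟩
    have : (aeval (derivEnd a b τ) (p₁ + p₂) x : ℝ → ℂ) =
        (aeval (derivEnd a b τ) p₁ x : ℝ → ℂ) + (aeval (derivEnd a b τ) p₂ x : ℝ → ℂ) := by
      rw [map_add]; rfl
    rw [this, laplaceNum_add (continuous_of_mem_decayingSolutions (Subtype.prop _))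
      (continuous_of_mem_decayingSolutions (Subtype.prop _)), e₁, e₂, eval_add, Pi.add_apply]
    ring
  | monomial n c h =>
    obtain ⟨q, hq, e⟩ := h (derivEnd a b τ x)
    refine ⟨fun z => q z - (C c * X ^ n : ℂ[X]).eval z * (x : ℝ → ℂ) 0, ?_, fun z => ?_⟩
    · exact hq.sub ((Polynomial.differentiable _).mul_const _)
    · rw [pow_succ, ← mul_assoc, map_mul, aeval_X, Module.End.mul_apply, e, eval_mul (q := X),
        eval_X, laplaceNum_derivEnd]
      ring

open Polynomial in
/-- If `p` vanishes at every unstable characteristic root to at least the order of `χ`, then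
`p(d/dt)` annihilates all decaying solutions. -/
lemma aeval_derivEnd_eq_zero (hτ : 0 ≤ τ) (p : ℂ[X])
    (hp : ∀ z ∈ unstableRoots a b τ, ∃ m : ℕ, analyticOrderAt (charFn a b τ) z = m ∧
      (X - C z) ^ m ∣ p) : aeval (derivEnd a b τ) p = 0 := by
  have key : ∀ x : decayingSolutions a b τ, (aeval (derivEnd a b τ) p x : ℝ → ℂ) 0 = 0 := by
    intro x
    refine eq_zero_of_laplaceQuot_order_nonneg hτ (Subtype.prop _) fun z hz => ?_
    have hχ := (differentiable_charFn a b τ).analyticAt z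
    have hN : ∀ y : decayingSolutions a b τ, AnalyticAt ℂ (laplaceNum b τ y) z := fun y =>
      (differentiable_laplaceNum (continuous_of_mem_decayingSolutions y.2)).analyticAt z
    rcases eq_or_ne (charFn a b τ z) 0 with h0 | h0
    · obtain ⟨m, hm, r, hr⟩ := hp z ⟨h0, hz⟩
      obtain ⟨u, hu, hu0, hue⟩ := hχ.analyticOrderAt_eq_natCast.1 hm
      obtain ⟨q, hq, e⟩ := exists_laplaceNum_aeval p x
      -- Near z, χ = (w - z)^m u with u(z) ≠ 0 and p = (w - z)^m r, so the pole of N/χ is cancelled.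
      have han : AnalyticAt ℂ (fun w => r.eval w * laplaceNum b τ x w / u w + q w) z :=
        ((((Polynomial.differentiable r).analyticAt z).mul (hN x)).div hu hu0).add
          (hq.analyticAt z)
      rw [meromorphicOrderAt_congr (f₂ := fun w => r.eval w * laplaceNum b τ x w / u w + q w)]
      · exact han.meromorphicOrderAt_nonneg
      · filter_upwards [nhdsWithin_le_nhds hue, self_mem_nhdsWithin,
          nhdsWithin_le_nhds (hu.continuousAt.eventually_ne hu0)] with w hw hwz huw
        have hwz' : w - z ≠ 0 := sub_ne_zero.2 hwz
        rw [laplaceQuot, e, hw, hr, eval_mul, eval_pow, eval_sub, eval_X, eval_C, smul_eq_mul]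
        field_simp
    · exact ((hN _).div hχ h0).meromorphicOrderAt_nonneg
  refine LinearMap.ext fun x => Subtype.ext (funext fun t => ?_)
  -- The value at 0 vanishes for every solution; applying this to translates gives every t.
  have hcomm : Commute (shiftEnd a b τ (-t)) (aeval (derivEnd a b τ) p) := by
    refine Polynomial.induction_on p (fun c => ?_) (fun p q hp hq => ?_) (fun n c _ => ?_)
    · rw [aeval_C]; exact Algebra.commute_algebraMap_right c _
    · rw [map_add]; exact hp.add_right hq
    · rw [map_mul, map_pow, aeval_C, aeval_X]
      exact (Algebra.commute_algebraMap_right c _).mul_right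
        ((commute_shiftEnd_derivEnd _).pow_right _)
  have h := key (shiftEnd a b τ (-t) x)
  rw [← Module.End.mul_apply, ← hcomm.eq, Module.End.mul_apply] at h
  change (aeval (derivEnd a b τ) p x : ℝ → ℂ) (0 - -t) = 0 at h
  simpa using h

/-! ### The dimension equals the number of unstable roots -/

lemma rank_ker_mul_le {V : Type*} [AddCommGroup V] [Module ℂ V] (g f : Module.End ℂ V) :
    Module.rank ℂ (LinearMap.ker (g * f)) ≤
      Module.rank ℂ (LinearMap.ker g) + Module.rank ℂ (LinearMap.ker f) := by
  let φ : LinearMap.ker (g * f) →ₗ[ℂ] LinearMap.ker g :=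
    f.restrict fun x hx => by simpa using hx
  rw [← LinearMap.rank_range_add_rank_ker φ]
  refine add_le_add (Submodule.rank_le _) ?_
  refine LinearMap.rank_le_of_injective (LinearMap.codRestrict (LinearMap.ker f)
    ((LinearMap.ker (g * f)).subtype ∘ₗ (LinearMap.ker φ).subtype) fun x => ?_) ?_
  · have := x.2
    rw [LinearMap.mem_ker, Subtype.ext_iff] at this
    exact this
  · intro x y hxy
    have h : ((x : LinearMap.ker (g * f)) : V) = ((y : LinearMap.ker (g * f)) : V) :=
      congrArg (fun v : LinearMap.ker f => (v : V)) hxy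
    exact Subtype.ext (Subtype.ext h)

open Polynomial in
lemma rank_ker_aeval_prod_le {V : Type*} [AddCommGroup V] [Module ℂ V] (f : Module.End ℂ V)
    (hf : ∀ μ : ℂ, Module.rank ℂ (LinearMap.ker (f - algebraMap ℂ _ μ)) ≤ 1)
    (s : Multiset ℂ) :
    Module.rank ℂ (LinearMap.ker (aeval f (s.map fun μ => X - C μ).prod)) ≤ s.card := by
  induction s using Multiset.induction_on with
  | empty =>
    rw [Multiset.map_zero, Multiset.prod_zero, map_one, Module.End.one_eq_id, LinearMap.ker_id]
    simp
  | cons μ s ih =>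
    rw [Multiset.map_cons, Multiset.prod_cons, map_mul, Multiset.card_cons, Nat.cast_add,
      add_comm, Nat.cast_one]
    refine (rank_ker_mul_le _ _).trans (add_le_add ?_ ih)
    rw [map_sub, aeval_X, aeval_C]
    exact hf μ

lemma eq_mul_exp_of_hasDerivAt {x : ℝ → ℂ} {μ : ℂ} (hx : ∀ t, HasDerivAt x (μ * x t) t) (t : ℝ) :
    x t = x 0 * exp (μ * t) := by
  have hd : ∀ t : ℝ, HasDerivAt (fun t : ℝ => x t * exp (-μ * t)) 0 t := by
    intro t
    have h : HasDerivAt (fun t : ℝ => -μ * (t : ℂ)) (-μ) t := by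
      simpa using (ofRealCLM.hasDerivAt (x := t)).const_mul (-μ)
    exact ((hx t).mul h.cexp).congr_deriv (by ring)
  have h := is_const_of_deriv_eq_zero (fun t => (hd t).differentiableAt) (fun t => (hd t).deriv) t 0
  simp only [ofReal_zero, mul_zero, exp_zero, mul_one] at h
  rw [← h, mul_assoc, ← exp_add]
  simp

lemma eq_mul_exp_of_mem_ker {μ : ℂ} {x : decayingSolutions a b τ}
    (hx : derivEnd a b τ x = μ • x) (t : ℝ) :
    (x : ℝ → ℂ) t = (x : ℝ → ℂ) 0 * exp (μ * t) :=
  eq_mul_exp_of_hasDerivAt (fun t => by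
    have := hasDerivAt_derivEnd x t
    rwa [hx] at this) t

lemma rank_ker_derivEnd_sub_le (μ : ℂ) :
    Module.rank ℂ (LinearMap.ker (derivEnd a b τ - algebraMap ℂ _ μ)) ≤ 1 := by
  let φ : LinearMap.ker (derivEnd a b τ - algebraMap ℂ _ μ) →ₗ[ℂ] ℂ :=
    LinearMap.proj 0 ∘ₗ (decayingSolutions a b τ).subtype ∘ₗ Submodule.subtype _
  rw [← Module.rank_self ℂ]
  refine LinearMap.rank_le_of_injective φ ?_
  have hx' : ∀ (x : LinearMap.ker (derivEnd a b τ -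
      algebraMap ℂ (Module.End ℂ (decayingSolutions a b τ)) μ)) (t : ℝ),
      (x.1 : ℝ → ℂ) t = (x.1 : ℝ → ℂ) 0 * exp (μ * t) := fun x =>
    eq_mul_exp_of_mem_ker (by
      have h := LinearMap.mem_ker.1 x.2
      rwa [LinearMap.sub_apply, Module.algebraMap_end_apply, sub_eq_zero] at h)
  refine fun x y hxy => Subtype.ext (Subtype.ext (funext fun t => ?_))
  have h : (x.1 : ℝ → ℂ) 0 = (y.1 : ℝ → ℂ) 0 := hxy
  rw [hx' x t, hx' y t, h]

lemma hasDerivAt_charFn (a b τ : ℝ) (z : ℂ) :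
    HasDerivAt (charFn a b τ) (1 + b * τ * exp (-z * τ)) z := by
  have h : HasDerivAt (fun z : ℂ => -z * (τ : ℂ)) (-τ) z := by
    simpa using (hasDerivAt_id z).neg.mul_const (τ : ℂ)
  exact (((hasDerivAt_id z).sub_const (a : ℂ)).sub (h.cexp.const_mul (b : ℂ))).congr_deriv (by ring)

/-- Characteristic roots have multiplicity at most two. -/
lemma analyticOrderAt_charFn {z : ℂ} (hz : charFn a b τ z = 0) :
    analyticOrderAt (charFn a b τ) z =
      ((if 1 + b * τ * exp (-z * τ) = 0 then 2 else 1 : ℕ) : ℕ∞) := by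
  have han := (differentiable_charFn a b τ).analyticAt z
  have hd1 : deriv (charFn a b τ) = fun z => 1 + b * τ * exp (-z * τ) :=
    funext fun z => (hasDerivAt_charFn a b τ z).deriv
  have hd2 : deriv (fun z : ℂ => 1 + b * τ * exp (-z * τ)) z = -(b * τ ^ 2 * exp (-z * τ)) := by
    have h : HasDerivAt (fun z : ℂ => -z * (τ : ℂ)) (-τ) z := by
      simpa using (hasDerivAt_id z).neg.mul_const (τ : ℂ)
    rw [((h.cexp.const_mul (b * τ : ℂ)).const_add 1).deriv]
    ring
  have hle := fun n => natCast_le_analyticOrderAt_iff_iteratedDeriv_eq_zero (n := n) han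
  have h1 : ((1 : ℕ) : ℕ∞) ≤ analyticOrderAt (charFn a b τ) z :=
    (hle 1).2 fun i hi => by
      interval_cases i
      simpa using hz
  split_ifs with h
  · refine le_antisymm (not_lt.1 fun hlt => ?_) ((hle 2).2 fun i hi => ?_)
    · have h3 : ((3 : ℕ) : ℕ∞) ≤ analyticOrderAt (charFn a b τ) z := Order.add_one_le_of_lt hlt
      have := (hle 3).1 h3 2 (by norm_num)
      rw [iteratedDeriv_succ, iteratedDeriv_one, hd1, hd2] at this
      -- Where χ' = 0, the second derivative -b τ² e^{-zτ} equals τ; and τ = 0 would make χ' = 1.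
      have h4 : (τ : ℂ) = 0 := by linear_combination (τ : ℂ) * h + this
      simp [h4] at h
    · interval_cases i
      · simpa using hz
      · rw [iteratedDeriv_one, hd1]; exact h
  · refine le_antisymm (not_lt.1 fun hlt => h ?_) h1
    have h3 : ((2 : ℕ) : ℕ∞) ≤ analyticOrderAt (charFn a b τ) z := Order.add_one_le_of_lt hlt
    have := (hle 2).1 h3 1 (by norm_num)
    rwa [iteratedDeriv_one, hd1] at this

lemma tendsto_exp_mul_atBot {z : ℂ} (hz : 0 < z.re) :
    Tendsto (fun t : ℝ => exp (z * t)) atBot (𝓝 0) := by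
  rw [tendsto_zero_iff_norm_tendsto_zero]
  have : (fun t : ℝ => ‖exp (z * t)‖) = fun t => Real.exp (z.re * t) := by
    funext t; simp [norm_exp]
  rw [this]
  exact Real.tendsto_exp_atBot.comp (tendsto_id.const_mul_atBot hz)

lemma hasDerivAt_exp_mul (z : ℂ) (t : ℝ) :
    HasDerivAt (fun t : ℝ => exp (z * t)) (z * exp (z * t)) t := by
  have h : HasDerivAt (fun t : ℝ => z * (t : ℂ)) z t := by
    simpa using (ofRealCLM.hasDerivAt (x := t)).const_mul z
  exact h.cexp.congr_deriv (mul_comm _ _)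

lemma exp_mul_sub (z : ℂ) (t τ : ℝ) : exp (z * ((t - τ : ℝ) : ℂ)) = exp (-z * τ) * exp (z * t) := by
  rw [← exp_add]; congr 1; push_cast; ring

lemma exp_mem_decayingSolutions {z : ℂ} (hz : z ∈ unstableRoots a b τ) :
    (fun t : ℝ => exp (z * t)) ∈ decayingSolutions a b τ := by
  refine ⟨fun t => (hasDerivAt_exp_mul z t).congr_deriv ?_, tendsto_exp_mul_atBot hz.2⟩
  have h := hz.1
  rw [charFn] at h
  simp only [exp_mul_sub]
  linear_combination exp (z * t) * h

/-- Inserting t e^{zt} into the equation leaves χ(z) as coefficient of t e^{zt} and χ'(z) as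
coefficient of e^{zt}. -/
lemma mul_exp_mem_decayingSolutions {z : ℂ} (hz : z ∈ unstableRoots a b τ)
    (hz' : 1 + b * τ * exp (-z * τ) = 0) :
    (fun t : ℝ => t * exp (z * t)) ∈ decayingSolutions a b τ := by
  refine ⟨fun t => ((ofRealCLM.hasDerivAt (x := t)).mul (hasDerivAt_exp_mul z t)).congr_deriv ?_, ?_⟩
  · have h := hz.1
    rw [charFn] at h
    simp only [exp_mul_sub]
    simp only [ofRealCLM_apply, ofReal_one, ofReal_sub]
    linear_combination t * exp (z * t) * h + exp (z * t) * hz'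
  · rw [tendsto_zero_iff_norm_tendsto_zero]
    have : (fun t : ℝ => ‖(t : ℂ) * exp (z * t)‖) =
        fun t => |t * Real.exp (z.re * t)| := by
      funext t
      rw [norm_mul, abs_mul, norm_real, Real.norm_eq_abs, abs_of_pos (Real.exp_pos _)]
      simp [norm_exp]
    rw [this, ← abs_zero]
    refine Tendsto.abs ?_
    have h1 := (Real.tendsto_pow_mul_exp_neg_atTop_nhds_zero 1).comp
      (tendsto_neg_atBot_atTop.comp (tendsto_id.const_mul_atBot hz.2))
    have h2 := h1.const_mul (-(1 / z.re))
    rw [mul_zero] at h2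
    refine h2.congr fun t => ?_
    have := hz.2.ne'
    simp
    field_simp

/-- A Jordan chain of length two, applied to v = e^{zt} and w = t e^{zt}. -/
lemma two_le_finrank_maxGenEigenspace {V : Type*} [AddCommGroup V] [Module ℂ V]
    [FiniteDimensional ℂ V] {f : Module.End ℂ V} {z : ℂ} {v w : V} (hv0 : v ≠ 0)
    (hv : f v = z • v) (hw : f w = z • w + v) :
    2 ≤ Module.finrank ℂ (f.maxGenEigenspace z) := by
  have hv' : (f - z • (1 : Module.End ℂ V)) v = 0 := by simp [hv]
  have hw' : (f - z • (1 : Module.End ℂ V)) w = v := by simp [hw]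
  have hmem : v ∈ f.maxGenEigenspace z :=
    (Module.End.mem_maxGenEigenspace _ _ _).2 ⟨1, by rw [pow_one, hv']⟩
  have hmem' : w ∈ f.maxGenEigenspace z :=
    (Module.End.mem_maxGenEigenspace _ _ _).2 ⟨2, by
      rw [pow_two, Module.End.mul_apply, hw', hv']⟩
  have hli : LinearIndependent ℂ ![(⟨v, hmem⟩ : f.maxGenEigenspace z), ⟨w, hmem'⟩] := by
    refine LinearIndependent.pair_iff.2 fun c d hcd => ?_
    have hcd' : c • v + d • w = 0 := congrArg Subtype.val hcd
    have h := congrArg (f - z • (1 : Module.End ℂ V)) hcd'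
    rw [map_add, map_smul, map_smul, hv', hw', smul_zero, zero_add, map_zero] at h
    have hd : d = 0 := (smul_eq_zero.1 h).resolve_right hv0
    rw [hd, zero_smul, add_zero] at hcd'
    exact ⟨(smul_eq_zero.1 hcd').resolve_right hv0, hd⟩
  simpa using hli.fintype_card_le_finrank

lemma one_le_finrank_maxGenEigenspace {V : Type*} [AddCommGroup V] [Module ℂ V]
    [FiniteDimensional ℂ V] {f : Module.End ℂ V} {z : ℂ} {v : V} (hv0 : v ≠ 0)
    (hv : f v = z • v) : 1 ≤ Module.finrank ℂ (f.maxGenEigenspace z) := by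
  have hmem : v ∈ f.maxGenEigenspace z :=
    (Module.End.mem_maxGenEigenspace _ _ _).2 ⟨1, by simp [hv]⟩
  refine Nat.one_le_iff_ne_zero.2 fun h0 => hv0 ?_
  rw [Submodule.finrank_eq_zero] at h0
  rwa [h0, Submodule.mem_bot] at hmem

lemma analyticOrderNatAt_le_finrank [FiniteDimensional ℂ (decayingSolutions a b τ)] {z : ℂ}
    (hz : z ∈ unstableRoots a b τ) : analyticOrderNatAt (charFn a b τ) z ≤
      Module.finrank ℂ ((derivEnd a b τ).maxGenEigenspace z) := by
  obtain ⟨v, hv⟩ : ∃ v : decayingSolutions a b τ, (v : ℝ → ℂ) = fun t : ℝ => exp (z * t) :=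
    ⟨⟨_, exp_mem_decayingSolutions hz⟩, rfl⟩
  have hv0 : v ≠ 0 := by
    rintro rfl
    simpa using congrFun hv 0
  have heig : derivEnd a b τ v = z • v := by
    refine Subtype.ext (funext fun t => (hasDerivAt_derivEnd v t).unique ?_)
    rw [Submodule.coe_smul, hv]
    exact hasDerivAt_exp_mul z t
  rw [analyticOrderNatAt, analyticOrderAt_charFn hz.1, ENat.toNat_natCast]
  split_ifs with h
  · obtain ⟨w, hw⟩ : ∃ w : decayingSolutions a b τ, (w : ℝ → ℂ) = fun t : ℝ => t * exp (z * t) :=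
      ⟨⟨_, mul_exp_mem_decayingSolutions hz h⟩, rfl⟩
    refine two_le_finrank_maxGenEigenspace hv0 heig (w := w) ?_
    refine Subtype.ext (funext fun t => (hasDerivAt_derivEnd w t).unique ?_)
    rw [Submodule.coe_add, Submodule.coe_smul, hv, hw]
    refine ((ofRealCLM.hasDerivAt (x := t)).mul (hasDerivAt_exp_mul z t)).congr_deriv ?_
    simp
    ring
  · exact one_le_finrank_maxGenEigenspace hv0 heig

lemma sum_finrank_maxGenEigenspace_le {V : Type*} [AddCommGroup V] [Module ℂ V]
    [FiniteDimensional ℂ V] (f : Module.End ℂ V) (S : Finset ℂ) :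
    ∑ μ ∈ S, Module.finrank ℂ (f.maxGenEigenspace μ) ≤ Module.finrank ℂ V := by
  classical
  have hind : iSupIndep fun μ : S => f.maxGenEigenspace (μ : ℂ) :=
    f.independent_maxGenEigenspace.comp Subtype.val_injective
  have := LinearMap.finrank_le_finrank_of_injective
    (f := (DFinsupp.lsum ℂ fun μ : S => (f.maxGenEigenspace (μ : ℂ)).subtype))
    hind.dfinsupp_lsum_injective
  rw [← Finset.sum_coe_sort]
  exact (Module.finrank_directSum ℂ fun μ : S => f.maxGenEigenspace (μ : ℂ)).symm.trans_le this

open Polynomial in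
lemma finiteDimensional_decayingSolutions_and_finrank_le (hτ : 0 ≤ τ)
    (hfin : (unstableRoots a b τ).Finite) :
    FiniteDimensional ℂ (decayingSolutions a b τ) ∧
      Module.finrank ℂ (decayingSolutions a b τ) ≤ numUnstableRoots a b τ := by
  classical
  set m : ℂ → ℕ := analyticOrderNatAt (charFn a b τ)
  set s : Multiset ℂ := ∑ μ ∈ hfin.toFinset, Multiset.replicate (m μ) μ with hs
  have hcard : s.card = numUnstableRoots a b τ := by
    rw [hs, Multiset.card_sum, numUnstableRoots, finsum_mem_eq_finite_toFinset_sum _ hfin]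
    simp [m]
  have h0 : aeval (derivEnd a b τ) (s.map fun μ => X - C μ).prod = 0 := by
    refine aeval_derivEnd_eq_zero hτ _ fun z hz => ⟨m z, ?_, ?_⟩
    · simp only [m, analyticOrderNatAt, analyticOrderAt_charFn hz.1, ENat.toNat_natCast]
    · have hle : Multiset.replicate (m z) z ≤ s := by
        rw [hs]
        exact Finset.single_le_sum (f := fun μ => Multiset.replicate (m μ) μ)
          (fun _ _ => Multiset.zero_le _) (hfin.mem_toFinset.2 hz)
      have := Multiset.prod_dvd_prod_of_le (Multiset.map_le_map (f := fun μ => X - C μ) hle)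
      rwa [Multiset.map_replicate, Multiset.prod_replicate] at this
  -- Since p(D) = 0, its kernel is the whole space, and deg p bounds the dimension.
  have hrank := rank_ker_aeval_prod_le (derivEnd a b τ) rank_ker_derivEnd_sub_le s
  rw [h0, LinearMap.ker_zero, rank_top, hcard] at hrank
  have hfd : FiniteDimensional ℂ (decayingSolutions a b τ) :=
    Module.rank_lt_aleph0_iff.1 (hrank.trans_lt Cardinal.natCast_lt_aleph0)
  refine ⟨hfd, ?_⟩
  rw [← Module.finrank_eq_rank] at hrank
  exact_mod_cast hrank

theorem finrank_decayingSolutions (hτ : 0 ≤ τ) (hfin : (unstableRoots a b τ).Finite) :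
    Module.finrank ℂ (decayingSolutions a b τ) = numUnstableRoots a b τ := by
  obtain ⟨hfd, hle⟩ := finiteDimensional_decayingSolutions_and_finrank_le hτ hfin
  refine le_antisymm hle ?_
  rw [numUnstableRoots, finsum_mem_eq_finite_toFinset_sum _ hfin]
  refine le_trans (Finset.sum_le_sum fun z hz => ?_)
    (sum_finrank_maxGenEigenspace_le (derivEnd a b τ) hfin.toFinset)
  exact analyticOrderNatAt_le_finrank (hfin.mem_toFinset.1 hz)

/-! ### From complex solutions to real history segments -/

lemma derivEnd_eq_zero_of_eqOn (hτ : 0 ≤ τ) {x : decayingSolutions a b τ}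
    (hx : ∀ t ∈ Set.Icc (-τ) 0, (x : ℝ → ℂ) t = 0) :
    ∀ t ∈ Set.Icc (-τ) 0, (derivEnd a b τ x : ℝ → ℂ) t = 0 := by
  intro t ht
  rcases hτ.eq_or_lt with rfl | hτ
  · rw [derivEnd_apply, sub_zero, hx t ht]
    simp
  -- In general t - τ lies outside the interval, so the right-hand side of the equation says
  -- nothing; the derivative within the interval does.
  · have hu := uniqueDiffOn_Icc (neg_lt_zero.2 hτ) t ht
    refine hu.eq_deriv _ (hasDerivAt_derivEnd x t).hasDerivWithinAt ?_
    exact (hasDerivWithinAt_const t _ (0 : ℂ)).congr (fun s hs => hx s hs) (hx t ht)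

/-- A decaying solution that vanishes on the history interval vanishes identically. -/
lemma eq_zero_of_eqOn_Icc (hτ : 0 ≤ τ) [FiniteDimensional ℂ (decayingSolutions a b τ)]
    {x : decayingSolutions a b τ} (hx : ∀ t ∈ Set.Icc (-τ) 0, (x : ℝ → ℂ) t = 0) : x = 0 := by
  -- The solutions vanishing on the history interval form a D-invariant, finite-dimensional space.
  -- If nonzero, it contains an eigenvector c e^{μt}, and its value c at 0 vanishes.
  let K : Submodule ℂ (decayingSolutions a b τ) :=
    { carrier := {y | ∀ t ∈ Set.Icc (-τ) 0, (y : ℝ → ℂ) t = 0}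
      zero_mem' := fun _ _ => rfl
      add_mem' := fun {y z} hy hz t ht => by
        change (y : ℝ → ℂ) t + (z : ℝ → ℂ) t = 0
        rw [hy t ht, hz t ht, add_zero]
      smul_mem' := fun c y hy t ht => by
        change c * (y : ℝ → ℂ) t = 0
        rw [hy t ht, mul_zero] }
  by_contra hne
  have : Nontrivial K := ⟨⟨x, hx⟩, 0, fun h => hne (congrArg Subtype.val h)⟩
  obtain ⟨μ, hμ⟩ := Module.End.exists_eigenvalue (K := ℂ) (V := K)
    ((derivEnd a b τ).restrict (p := K) (q := K) fun y hy => derivEnd_eq_zero_of_eqOn hτ hy)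
  obtain ⟨v, hv⟩ := hμ.exists_hasEigenvector
  have heig : derivEnd a b τ v = μ • (v : decayingSolutions a b τ) :=
    congrArg Subtype.val hv.apply_eq_smul
  refine hv.2 (Subtype.ext (Subtype.ext (funext fun t => ?_)))
  rw [eq_mul_exp_of_mem_ker heig, v.2 0 ⟨neg_nonpos.2 hτ, le_rfl⟩, zero_mul]
  rfl

lemma re_mem {x : ℝ → ℂ} (hx : x ∈ decayingSolutions a b τ) :
    IsEntireSolution a b τ (fun t => (x t).re) ∧ Tendsto (fun t => (x t).re) atBot (𝓝 0) := by
  refine ⟨fun t => ?_, (continuous_re.tendsto 0).comp hx.2⟩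
  refine (reCLM.hasFDerivAt.comp_hasDerivAt t (hx.1 t)).congr_deriv ?_
  simp

lemma im_mem {x : ℝ → ℂ} (hx : x ∈ decayingSolutions a b τ) :
    IsEntireSolution a b τ (fun t => (x t).im) ∧ Tendsto (fun t => (x t).im) atBot (𝓝 0) := by
  refine ⟨fun t => ?_, (continuous_im.tendsto 0).comp hx.2⟩
  refine (imCLM.hasFDerivAt.comp_hasDerivAt t (hx.1 t)).congr_deriv ?_
  simp

lemma ofReal_mem {x : ℝ → ℝ} (hx : IsEntireSolution a b τ x) (hx0 : Tendsto x atBot (𝓝 0)) :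
    (fun t => (x t : ℂ)) ∈ decayingSolutions a b τ := by
  refine ⟨fun t => (hx t).ofReal_comp.congr_deriv (by push_cast; ring), ?_⟩
  exact (continuous_ofReal.tendsto 0).comp hx0

/-- Restriction of real and imaginary part to the history interval. -/
noncomputable def restrictReIm (a b τ : ℝ) :
    decayingSolutions a b τ →ₗ[ℝ] unstableManifold a b τ × unstableManifold a b τ where
  toFun x :=
    (⟨⟨fun θ => ((x : ℝ → ℂ) θ).re, continuous_re.comp
        ((continuous_of_mem_decayingSolutions x.2).comp continuous_subtype_val)⟩,
      _, (re_mem x.2).1, (re_mem x.2).2, fun _ => rfl⟩,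
     ⟨⟨fun θ => ((x : ℝ → ℂ) θ).im, continuous_im.comp
        ((continuous_of_mem_decayingSolutions x.2).comp continuous_subtype_val)⟩,
      _, (im_mem x.2).1, (im_mem x.2).2, fun _ => rfl⟩)
  map_add' x y := rfl
  map_smul' c x := by
    refine Prod.ext (Subtype.ext (ContinuousMap.ext fun θ => ?_))
      (Subtype.ext (ContinuousMap.ext fun θ => ?_))
    · change (c • (x : ℝ → ℂ) θ).re = c * ((x : ℝ → ℂ) θ).re
      simp
    · change (c • (x : ℝ → ℂ) θ).im = c * ((x : ℝ → ℂ) θ).im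
      simp

lemma restrictReIm_bijective (hτ : 0 ≤ τ) [FiniteDimensional ℂ (decayingSolutions a b τ)] :
    Function.Bijective (restrictReIm a b τ) := by
  constructor
  · refine LinearMap.ker_eq_bot.1 (LinearMap.ker_eq_bot'.2 fun x hx => ?_)
    refine eq_zero_of_eqOn_Icc hτ fun t ht => Complex.ext ?_ ?_
    · exact DFunLike.congr_fun (congrArg Subtype.val (congrArg Prod.fst hx)) ⟨t, ht⟩
    · exact DFunLike.congr_fun (congrArg Subtype.val (congrArg Prod.snd hx)) ⟨t, ht⟩
  · rintro ⟨⟨ψ, x, hx, hx0, hψ⟩, ⟨φ, y, hy, hy0, hφ⟩⟩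
    refine ⟨⟨_, ofReal_mem hx hx0⟩ + I • ⟨_, ofReal_mem hy hy0⟩, ?_⟩
    refine Prod.ext (Subtype.ext (ContinuousMap.ext fun θ => ?_))
      (Subtype.ext (ContinuousMap.ext fun θ => ?_))
    · change ((x θ : ℂ) + I * (y θ : ℂ)).re = ψ θ
      simp [hψ]
    · change ((x θ : ℂ) + I * (y θ : ℂ)).im = φ θ
      simp [hφ]

theorem finrank_unstableManifold (hτ : 0 ≤ τ) (hfin : (unstableRoots a b τ).Finite) :
    FiniteDimensional ℝ (unstableManifold a b τ) ∧
      Module.finrank ℝ (unstableManifold a b τ) = numUnstableRoots a b τ := by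
  have hfd := (finiteDimensional_decayingSolutions_and_finrank_le hτ hfin).1
  have hfdR : FiniteDimensional ℝ (decayingSolutions a b τ) := Module.Finite.trans ℂ _
  let e := LinearEquiv.ofBijective (restrictReIm a b τ) (restrictReIm_bijective hτ)
  have hfdU : FiniteDimensional ℝ (unstableManifold a b τ) :=
    Module.Finite.of_surjective (LinearMap.fst ℝ _ _ ∘ₗ e.toLinearMap)
      (Prod.fst_surjective.comp e.surjective)
  refine ⟨hfdU, ?_⟩
  have h1 := e.finrank_eq
  -- The real dimension is twice the complex dimension, and also twice that of the unstable
  -- manifold.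
  rw [Module.finrank_prod, ← Module.finrank_mul_finrank ℝ ℂ, Complex.finrank_real_complex,
    finrank_decayingSolutions hτ hfin] at h1
  omega

/-! ### The curves on which u e^u is real -/

/-- Real part of the point `u` with `arg u = α` and `im u = n π - α`; such points are exactly those
in the upper half plane for which `u e^u` is real. -/
noncomputable def curveRe (n : ℕ) (α : ℝ) : ℝ :=
  (n * Real.pi - α) * (Real.cos α / Real.sin α)

/-- The modulus of `u e^u` at the point `u` with `arg u = α` and `im u = n π - α`. -/
noncomputable def curveMod (n : ℕ) (α : ℝ) : ℝ :=
  (n * Real.pi - α) / Real.sin α * Real.exp (curveRe n α)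

lemma pi_sub_le_curveIm {n : ℕ} (hn : 1 ≤ n) (α : ℝ) : Real.pi - α ≤ n * Real.pi - α := by
  have : (1 : ℝ) ≤ n := by exact_mod_cast hn
  nlinarith [Real.pi_pos]

lemma curveIm_pos {n : ℕ} (hn : 1 ≤ n) {α : ℝ} (hα : α ∈ Set.Ioo 0 Real.pi) :
    0 < n * Real.pi - α :=
  (sub_pos.2 hα.2).trans_le (pi_sub_le_curveIm hn α)

lemma sin_pos_of_mem {α : ℝ} (hα : α ∈ Set.Ioo 0 Real.pi) : 0 < Real.sin α :=
  Real.sin_pos_of_pos_of_lt_pi hα.1 hα.2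

lemma hasDerivAt_curveRe (n : ℕ) {α : ℝ} (hα : α ∈ Set.Ioo 0 Real.pi) :
    HasDerivAt (curveRe n)
      (-((n * Real.pi - α) + Real.sin α * Real.cos α) / Real.sin α ^ 2) α := by
  have hs := (sin_pos_of_mem hα).ne'
  refine (((hasDerivAt_id α).const_sub (n * Real.pi)).mul
    ((Real.hasDerivAt_cos α).div (Real.hasDerivAt_sin α) hs)).congr_deriv ?_
  simp only [id, Pi.div_apply]
  field_simp
  linear_combination (-(n * Real.pi - α)) * Real.sin_sq_add_cos_sq α

lemma continuousOn_curveRe (n : ℕ) : ContinuousOn (curveRe n) (Set.Ioo 0 Real.pi) :=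
  fun _ hα => (hasDerivAt_curveRe n hα).continuousAt.continuousWithinAt

/-- With β = π - α ≤ nπ - α, the sign of the derivative reduces to sin 2β < 2β. -/
lemma strictAntiOn_curveRe {n : ℕ} (hn : 1 ≤ n) :
    StrictAntiOn (curveRe n) (Set.Ioo 0 Real.pi) := by
  refine strictAntiOn_of_deriv_neg (convex_Ioo _ _) (continuousOn_curveRe n) fun α hα => ?_
  rw [interior_Ioo] at hα
  rw [(hasDerivAt_curveRe n hα).deriv]
  refine div_neg_of_neg_of_pos ?_ (pow_pos (sin_pos_of_mem hα) 2)
  have h1 := pi_sub_le_curveIm hn α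
  have h2 := Real.sin_lt (x := 2 * (Real.pi - α)) (by linarith [hα.2])
  have h3 : Real.sin (2 * (Real.pi - α)) = -(2 * Real.sin α * Real.cos α) := by
    rw [Real.sin_two_mul, Real.sin_pi_sub, Real.cos_pi_sub]; ring
  linarith

/-- Written as a sum of squares to make the sign visible: the bracket is sin² α |1 + u|², in
accordance with (u e^u)' = (1 + u) e^u. -/
lemma hasDerivAt_curveMod (n : ℕ) {α : ℝ} (hα : α ∈ Set.Ioo 0 Real.pi) :
    HasDerivAt (curveMod n) (-(Real.exp (curveRe n α) / Real.sin α ^ 3 *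
      ((Real.sin α + (n * Real.pi - α) * Real.cos α) ^ 2 +
        ((n * Real.pi - α) * Real.sin α) ^ 2))) α := by
  have hs := (sin_pos_of_mem hα).ne'
  refine ((((hasDerivAt_id α).const_sub (n * Real.pi)).div (Real.hasDerivAt_sin α) hs).mul
    (hasDerivAt_curveRe n hα).exp).congr_deriv ?_
  simp only [id, Pi.div_apply]
  field_simp
  linear_combination (n * Real.pi - α) ^ 2 * Real.sin_sq_add_cos_sq α

lemma continuousOn_curveMod (n : ℕ) : ContinuousOn (curveMod n) (Set.Ioo 0 Real.pi) :=
  fun _ hα => (hasDerivAt_curveMod n hα).continuousAt.continuousWithinAt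

lemma strictAntiOn_curveMod {n : ℕ} (hn : 1 ≤ n) :
    StrictAntiOn (curveMod n) (Set.Ioo 0 Real.pi) := by
  refine strictAntiOn_of_deriv_neg (convex_Ioo _ _) (continuousOn_curveMod n) fun α hα => ?_
  rw [interior_Ioo] at hα
  rw [(hasDerivAt_curveMod n hα).deriv, neg_lt_zero]
  have h1 := sin_pos_of_mem hα
  have h2 := curveIm_pos hn hα
  positivity

lemma sq_div_sin (n : ℕ) {α : ℝ} (hα : α ∈ Set.Ioo 0 Real.pi) :
    ((n * Real.pi - α) / Real.sin α) ^ 2 = curveRe n α ^ 2 + (n * Real.pi - α) ^ 2 := by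
  have hs := (sin_pos_of_mem hα).ne'
  rw [curveRe]
  field_simp
  linear_combination -(n * Real.pi - α) ^ 2 * Real.sin_sq_add_cos_sq α

lemma cos_div_sin_arctan_inv (K : ℝ) :
    Real.cos (Real.arctan K⁻¹) / Real.sin (Real.arctan K⁻¹) = K := by
  rw [← inv_div, ← Real.tan_eq_sin_div_cos, Real.tan_arctan, inv_inv]

lemma arctan_inv_mem {K : ℝ} (hK : 0 < K) :
    Real.arctan K⁻¹ ∈ Set.Ioo 0 (Real.pi / 2) :=
  ⟨by rw [← Real.arctan_zero]; exact Real.arctan_strictMono (by positivity),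
    Real.arctan_lt_pi_div_two _⟩

/-- Both functions blow up as α → 0; the witness arctan (1/K) has cotangent K. -/
lemma exists_le_curve {n : ℕ} (hn : 1 ≤ n) (K : ℝ) :
    ∃ α ∈ Set.Ioo 0 Real.pi, K ≤ curveRe n α ∧ K ≤ curveMod n α := by
  wlog hK : 0 < K generalizing K
  · obtain ⟨α, hα, h1, h2⟩ := this 1 one_pos
    exact ⟨α, hα, by linarith, by linarith⟩
  have hα := arctan_inv_mem hK
  set α := Real.arctan K⁻¹
  have hα' : α ∈ Set.Ioo 0 Real.pi := ⟨hα.1, by linarith [hα.2, Real.pi_pos]⟩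
  have h1 : 1 ≤ n * Real.pi - α := by
    linarith [pi_sub_le_curveIm hn α, hα.2, Real.pi_gt_three]
  have hre : K ≤ curveRe n α := by
    rw [curveRe, cos_div_sin_arctan_inv K]
    exact le_mul_of_one_le_left hK.le h1
  refine ⟨α, hα', hre, ?_⟩
  have h2 : 1 ≤ (n * Real.pi - α) / Real.sin α := by
    rw [one_le_div (sin_pos_of_mem hα')]
    exact (Real.sin_le_one α).trans h1
  refine le_trans ?_ (le_mul_of_one_le_left (Real.exp_pos _).le h2)
  linarith [Real.add_one_le_exp (curveRe n α)]

lemma exists_curveRe_le_of_two_le {n : ℕ} (hn : 2 ≤ n) (K : ℝ) :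
    ∃ α ∈ Set.Ioo 0 Real.pi, curveRe n α ≤ -K := by
  wlog hK : 0 < K generalizing K
  · obtain ⟨α, hα, h1⟩ := this 1 one_pos
    exact ⟨α, hα, by linarith⟩
  have hβ := arctan_inv_mem hK
  set β := Real.arctan K⁻¹ with hβdef
  refine ⟨Real.pi - β, ⟨by linarith [hβ.2, Real.pi_pos], by linarith [hβ.1]⟩, ?_⟩
  have hn' : (2 : ℝ) ≤ n := by exact_mod_cast hn
  rw [curveRe, Real.cos_pi_sub, Real.sin_pi_sub, neg_div, cos_div_sin_arctan_inv K]
  have : 1 ≤ n * Real.pi - (Real.pi - β) := by nlinarith [Real.pi_gt_three, hβ.1]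
  nlinarith

/-- For n = 1 the factor π - α cancels the pole of cot at π, and the limit there is -1 instead of
-∞; hence the condition A < 1. -/
lemma exists_curveRe_one_le {A : ℝ} (hA : A < 1) :
    ∃ α ∈ Set.Ioo 0 Real.pi, curveRe 1 α ≤ -A := by
  set M := max A 0
  have hM0 : 0 ≤ M := le_max_right _ _
  have hM1 : M < 1 := max_lt hA one_pos
  set β := Real.arccos M
  have hβ0 : 0 < β := Real.arccos_pos.2 hM1
  have hβ1 : β ≤ Real.pi / 2 := Real.arccos_le_pi_div_two.2 hM0
  have hcos : Real.cos β = M := Real.cos_arccos (by linarith) hM1.le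
  have hβ : β ∈ Set.Ioo 0 Real.pi := ⟨hβ0, by linarith [Real.pi_pos]⟩
  refine ⟨Real.pi - β, ⟨by linarith [hβ.2], by linarith⟩, ?_⟩
  rw [curveRe, Real.cos_pi_sub, Real.sin_pi_sub, hcos]
  have hs := sin_pos_of_mem hβ
  have h1 : 1 ≤ β / Real.sin β := (one_le_div hs).2 (Real.sin_le hβ0.le)
  have h2 : M ≤ β / Real.sin β * M := le_mul_of_one_le_left hM0 h1
  have h3 : ((1 : ℕ) * Real.pi - (Real.pi - β)) * (-M / Real.sin β) = -(β / Real.sin β * M) := by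
    push_cast; ring
  rw [h3]
  linarith [le_max_left A 0]

lemma exists_curveRe_eq {n : ℕ} (hn : 1 ≤ n) {A : ℝ} (h : 2 ≤ n ∨ A < 1) :
    ∃ α ∈ Set.Ioo 0 Real.pi, curveRe n α = -A := by
  obtain ⟨α₁, h₁, h₁', -⟩ := exists_le_curve hn (-A)
  obtain ⟨α₂, h₂, h₂'⟩ : ∃ α ∈ Set.Ioo 0 Real.pi, curveRe n α ≤ -A := by
    rcases hn.eq_or_lt with rfl | hn
    · exact exists_curveRe_one_le (h.resolve_left (by norm_num))
    · exact exists_curveRe_le_of_two_le hn A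
  obtain ⟨α, hα, h⟩ := isPreconnected_Ioo.intermediate_value h₂ h₁ (continuousOn_curveRe n)
    ⟨h₂', h₁'⟩
  exact ⟨α, hα, h⟩

/-- The arguments `α` of `w - A` for the roots `w` of `(w - A) e^w = B` with positive real part and
`im w = n π - α`. -/
def rootArgs (A B : ℝ) (n : ℕ) : Set ℝ :=
  {α | α ∈ Set.Ioo 0 Real.pi ∧ curveMod n α = |B| * Real.exp (-A) ∧ -A < curveRe n α}

lemma rootArgs_subsingleton (A B : ℝ) {n : ℕ} (hn : 1 ≤ n) : (rootArgs A B n).Subsingleton :=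
  fun _ hα _ hβ => (strictAntiOn_curveMod hn).injOn hα.1 hβ.1 (hα.2.1.trans hβ.2.1.symm)

/-- The given α is where w = u + A meets the imaginary axis. By monotonicity the root lies to the
right of it iff |u e^u| there is below |B| e^{-A}, that is |u| < |B|. -/
lemma rootArgs_nonempty_iff {A B : ℝ} {n : ℕ} (hn : 1 ≤ n) {α : ℝ} (hα : α ∈ Set.Ioo 0 Real.pi)
    (hA : curveRe n α = -A) :
    (rootArgs A B n).Nonempty ↔ A ^ 2 + (n * Real.pi - α) ^ 2 < B ^ 2 := by
  have hmod : curveMod n α < |B| * Real.exp (-A) ↔ A ^ 2 + (n * Real.pi - α) ^ 2 < B ^ 2 := by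
    rw [curveMod, hA, mul_lt_mul_iff_left₀ (Real.exp_pos _), ← sq_abs B,
      ← pow_lt_pow_iff_left₀ (div_nonneg (curveIm_pos hn hα).le (sin_pos_of_mem hα).le)
        (abs_nonneg B) two_ne_zero, sq_div_sin n hα, hA, neg_sq]
  rw [← hmod]
  constructor
  · rintro ⟨β, hβ, h1, h2⟩
    rw [← hA] at h2
    rw [← h1]
    exact strictAntiOn_curveMod hn hβ hα (((strictAntiOn_curveRe hn).lt_iff_gt hα hβ).1 h2)
  · intro h
    obtain ⟨β, hβ, h1, h2⟩ := exists_le_curve hn (max (-A + 1) (|B| * Real.exp (-A)))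
    obtain ⟨γ, hγ, h3⟩ := isPreconnected_Ioo.intermediate_value hα hβ (continuousOn_curveMod n)
      ⟨h.le, (le_max_right _ _).trans h2⟩
    refine ⟨γ, hγ, h3, ?_⟩
    rw [← hA]
    refine strictAntiOn_curveRe hn hγ hα (((strictAntiOn_curveMod hn).lt_iff_gt hα hγ).1 ?_)
    rwa [h3]

lemma mul_cos_lt_sin {β : ℝ} (hβ : β ∈ Set.Ioo 0 Real.pi) : β * Real.cos β < Real.sin β := by
  rcases lt_or_ge β (Real.pi / 2) with h | h
  · have hc : 0 < Real.cos β := Real.cos_pos_of_mem_Ioo ⟨by linarith [hβ.1, Real.pi_pos], h⟩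
    have := Real.lt_tan hβ.1 h
    rwa [Real.tan_eq_sin_div_cos, lt_div_iff₀ hc] at this
  · have := Real.cos_nonpos_of_pi_div_two_le_of_le h (by linarith [hβ.2, Real.pi_pos])
    nlinarith [sin_pos_of_mem hβ, hβ.1]

lemma neg_one_lt_curveRe_one {α : ℝ} (hα : α ∈ Set.Ioo 0 Real.pi) : -1 < curveRe 1 α := by
  have hs := sin_pos_of_mem hα
  have h := mul_cos_lt_sin (β := Real.pi - α) ⟨by linarith [hα.2], by linarith [hα.1]⟩
  rw [Real.cos_pi_sub, Real.sin_pi_sub] at h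
  rw [curveRe, Nat.cast_one, one_mul, ← mul_div_assoc, lt_div_iff₀ hs]
  linarith

lemma exp_neg_one_lt_curveMod_one {α : ℝ} (hα : α ∈ Set.Ioo 0 Real.pi) :
    Real.exp (-1) < curveMod 1 α := by
  have hs := sin_pos_of_mem hα
  have h1 : 1 < ((1 : ℕ) * Real.pi - α) / Real.sin α := by
    rw [one_lt_div hs, Nat.cast_one, one_mul, ← Real.sin_pi_sub]
    exact Real.sin_lt (by linarith [hα.2])
  have h2 := Real.exp_lt_exp.2 (neg_one_lt_curveRe_one hα)
  exact h2.trans (lt_mul_of_one_lt_left (Real.exp_pos _) h1)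

lemma exists_curveMod_one_lt {c : ℝ} (hc : Real.exp (-1) < c) :
    ∃ α ∈ Set.Ioo 0 Real.pi, curveMod 1 α < c := by
  have hsinc : Tendsto Real.sinc (𝓝[>] 0) (𝓝 1) := by
    have := Real.continuous_sinc.tendsto 0
    rw [Real.sinc_zero] at this
    exact this.mono_left nhdsWithin_le_nhds
  have hcos : Tendsto Real.cos (𝓝[>] 0) (𝓝 1) := by
    have := Real.continuous_cos.tendsto 0
    rw [Real.cos_zero] at this
    exact this.mono_left nhdsWithin_le_nhds
  -- This is the modulus on branch 1 at α = π - β; its limit at the end α = π is e^{-1}.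
  have hlim : Tendsto (fun β => (Real.sinc β)⁻¹ * Real.exp (-(Real.cos β / Real.sinc β)))
      (𝓝[>] 0) (𝓝 (1⁻¹ * Real.exp (-(1 / 1)))) :=
    (hsinc.inv₀ one_ne_zero).mul
      ((Real.continuous_exp.tendsto _).comp (hcos.div hsinc one_ne_zero).neg)
  rw [inv_one, div_one, one_mul] at hlim
  obtain ⟨β, hβc, hβ⟩ := ((hlim.eventually_lt_const hc).and
    (Ioo_mem_nhdsGT Real.pi_pos)).exists
  refine ⟨Real.pi - β, ⟨by linarith [hβ.2], by linarith [hβ.1]⟩, ?_⟩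
  rw [Real.sinc_of_ne_zero hβ.1.ne'] at hβc
  have hs := (sin_pos_of_mem hβ).ne'
  have hb := hβ.1.ne'
  have h1 : curveRe 1 (Real.pi - β) = -(Real.cos β / (Real.sin β / β)) := by
    rw [curveRe, Real.cos_pi_sub, Real.sin_pi_sub]
    push_cast
    field_simp
    ring
  have h2 : ((1 : ℕ) * Real.pi - (Real.pi - β)) / Real.sin (Real.pi - β) =
      (Real.sin β / β)⁻¹ := by
    rw [Real.sin_pi_sub, inv_div]
    push_cast
    ring
  rwa [curveMod, h2, h1]

/-- Branch 1 lies in re u > -1 ≥ -A, so only the modulus matters, and its range is (e^{-1}, ∞). -/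
lemma rootArgs_one_nonempty_iff {A B : ℝ} (hA : 1 ≤ A) :
    (rootArgs A B 1).Nonempty ↔ Real.exp (A - 1) < |B| := by
  have hc : Real.exp (-1) < |B| * Real.exp (-A) ↔ Real.exp (A - 1) < |B| := by
    have : Real.exp (-1) = Real.exp (A - 1) * Real.exp (-A) := by
      rw [← Real.exp_add]; congr 1; ring
    rw [this, mul_lt_mul_iff_left₀ (Real.exp_pos _)]
  rw [← hc]
  constructor
  · rintro ⟨α, hα, h1, -⟩
    rw [← h1]
    exact exp_neg_one_lt_curveMod_one hα
  · intro h
    obtain ⟨α, hα, hlt⟩ := exists_curveMod_one_lt h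
    obtain ⟨β, hβ, -, h2⟩ := exists_le_curve le_rfl (|B| * Real.exp (-A))
    obtain ⟨γ, hγ, h3⟩ := isPreconnected_Ioo.intermediate_value hα hβ (continuousOn_curveMod 1)
      ⟨hlt.le, h2⟩
    exact ⟨γ, hγ, h3, by linarith [neg_one_lt_curveRe_one hγ]⟩

lemma rootArgs_eq_empty {A B : ℝ} (h : |B| < |A|) {n : ℕ} (hn : 1 ≤ n) :
    ¬ (rootArgs A B n).Nonempty := by
  by_cases hc : 2 ≤ n ∨ A < 1
  · obtain ⟨α, hα, hA⟩ := exists_curveRe_eq hn hc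
    rw [rootArgs_nonempty_iff hn hα hA]
    have := sq_lt_sq.2 h
    nlinarith [sq_nonneg (n * Real.pi - α)]
  · push Not at hc
    obtain rfl : n = 1 := by omega
    rw [rootArgs_one_nonempty_iff hc.2, not_lt]
    rw [abs_of_pos (a := A) (by linarith [hc.2])] at h
    linarith [Real.add_one_le_exp (A - 1)]

/-- The crossing condition for the `n`-th branch, in polar coordinates `-A + i Ω = |B| e^{iθ}`. -/
lemma rootArgs_nonempty_iff_lt {A B Ω θ : ℝ} {n : ℕ} (hn : 1 ≤ n) (hB : B ≠ 0)
    (hθ : θ ∈ Set.Ioo 0 Real.pi) (hcos : -A = |B| * Real.cos θ) (hsin : Ω = |B| * Real.sin θ)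
    (hc : 2 ≤ n ∨ A < 1) : (rootArgs A B n).Nonempty ↔ n * Real.pi < Ω + θ := by
  obtain ⟨α, hα, hA⟩ := exists_curveRe_eq hn hc
  have hB' : 0 < |B| := abs_pos.2 hB
  have hΩ : 0 < Ω := hsin ▸ mul_pos hB' (sin_pos_of_mem hθ)
  have hsq : A ^ 2 + Ω ^ 2 = B ^ 2 := by
    rw [← neg_sq, hcos, hsin, ← sq_abs B]
    linear_combination |B| ^ 2 * Real.sin_sq_add_cos_sq θ
  rw [rootArgs_nonempty_iff hn hα hA, ← hsq, add_lt_add_iff_left,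
    pow_lt_pow_iff_left₀ (curveIm_pos hn hα).le hΩ.le two_ne_zero]
  -- Put β = nπ - Ω; the claim is β < α ↔ β < θ. Outside (0, π) both sides are decided at once.
  rcases le_or_gt (n * Real.pi - Ω) 0 with h0 | h0
  · exact iff_of_true (by linarith [hα.1]) (by linarith [hθ.1])
  rcases le_or_gt Real.pi (n * Real.pi - Ω) with h1 | h1
  · exact iff_of_false (by linarith [hα.2]) (by linarith [hθ.2])
  have hβ : n * Real.pi - Ω ∈ Set.Ioo 0 Real.pi := ⟨h0, h1⟩
  have hsβ := sin_pos_of_mem hβ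
  have e1 : n * Real.pi - α < Ω ↔ n * Real.pi - Ω < α := by
    constructor <;> intro h <;> linarith
  have e2 : n * Real.pi < Ω + θ ↔ 0 < Real.sin (θ - (n * Real.pi - Ω)) := by
    constructor
    · intro h
      exact Real.sin_pos_of_pos_of_lt_pi (by linarith) (by linarith [hθ.2])
    · intro h
      by_contra! hle
      exact h.not_ge (Real.sin_nonpos_of_nonpos_of_neg_pi_le (by linarith) (by linarith [hθ.1]))
  -- As the real part decreases, β < α means -A < Ω cot β, which in polar coordinates reads sin (θ -
  -- β) > 0.
  rw [e1, e2, ← (strictAntiOn_curveRe hn).lt_iff_gt hα hβ, hA, hcos, curveRe, sub_sub_cancel,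
    ← mul_div_assoc, lt_div_iff₀ hsβ, Real.sin_sub θ, ← sub_pos]
  have : Ω * Real.cos (n * Real.pi - Ω) -
      |B| * Real.cos θ * Real.sin (n * Real.pi - Ω) = |B| * (Real.sin θ *
        Real.cos (n * Real.pi - Ω) - Real.cos θ * Real.sin (n * Real.pi - Ω)) := by
    linear_combination Real.cos (n * Real.pi - Ω) * hsin
  rw [this, mul_pos_iff_of_pos_left hB']

/-- Multiplying (π - θ) cos (π - θ) < sin (π - θ) by |B| gives (π - θ) A < Ω. Thus n = 1 always
counts as crossed when A ≥ 1. -/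
lemma pi_lt_add_of_one_le {A B Ω θ : ℝ} (hA : 1 ≤ A)
    (hθ : θ ∈ Set.Ioo 0 Real.pi) (hcos : -A = |B| * Real.cos θ) (hsin : Ω = |B| * Real.sin θ) :
    Real.pi < Ω + θ := by
  have h := mul_cos_lt_sin (β := Real.pi - θ) ⟨by linarith [hθ.2], by linarith [hθ.1]⟩
  rw [Real.cos_pi_sub, Real.sin_pi_sub] at h
  have hB : 0 < |B| := by
    refine (abs_nonneg B).lt_of_ne fun h0 => ?_
    rw [← h0] at hcos
    linarith
  have h1 := mul_lt_mul_of_pos_left h hB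
  have h2 : |B| * ((Real.pi - θ) * -Real.cos θ) = (Real.pi - θ) * A := by
    linear_combination (Real.pi - θ) * hcos
  rw [h2, ← hsin] at h1
  nlinarith [hθ.2]

/-! ### The rescaled equation (w - A) e^w = B -/

/-- The unstable characteristic roots, rescaled by the delay: the solutions of `(w - A) e^w = B`
with positive real part. -/
def scaledRoots (A B : ℝ) : Set ℂ :=
  {w : ℂ | (w - A) * exp w = B ∧ 0 < w.re}

/-- The real solutions `x > 0` of `(x - A) e^x = B`. -/
def realRoots (A B : ℝ) : Set ℝ :=
  {x : ℝ | (x - A) * Real.exp x = B ∧ 0 < x}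

/-- The elements of `scaledRoots` in the open upper half plane. -/
def upperRoots (A B : ℝ) : Set ℂ :=
  {w : ℂ | w ∈ scaledRoots A B ∧ 0 < w.im}

/-- The branches `n` that carry an element of `upperRoots`. -/
def upperIdx (A B : ℝ) : Set ℕ :=
  {n : ℕ | 1 ≤ n ∧ 0 < (-1) ^ n * B ∧ (rootArgs A B n).Nonempty}

/-- The point on the `n`-th branch with argument `α`, shifted by `A`. -/
noncomputable def branchPoint (A : ℝ) (n : ℕ) (α : ℝ) : ℂ :=
  ⟨A + curveRe n α, n * Real.pi - α⟩

lemma neg_one_pow_mul_abs {B : ℝ} {n : ℕ} (h : 0 < (-1) ^ n * B) : (-1) ^ n * |B| = B := by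
  have h1 : |(-1 : ℝ) ^ n * B| = (-1) ^ n * B := abs_of_pos h
  rw [abs_mul, abs_pow, abs_neg, abs_one, one_pow, one_mul] at h1
  rw [h1, ← mul_assoc, ← mul_pow]
  simp

lemma branchPoint_sub (A : ℝ) (n : ℕ) {α : ℝ} (hα : α ∈ Set.Ioo 0 Real.pi) :
    branchPoint A n α - A = ((n * Real.pi - α) / Real.sin α : ℝ) * exp (α * I) := by
  have hs := (sin_pos_of_mem hα).ne'
  refine Complex.ext ?_ ?_
  · rw [re_ofReal_mul, exp_ofReal_mul_I_re]
    simp [branchPoint, curveRe]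
    field_simp
  · rw [im_ofReal_mul, exp_ofReal_mul_I_im]
    simp [branchPoint]
    field_simp

lemma branchPoint_mem {A B : ℝ} {n : ℕ} (hn : 1 ≤ n) (hB : 0 < (-1) ^ n * B) {α : ℝ}
    (hα : α ∈ rootArgs A B n) : branchPoint A n α ∈ upperRoots A B := by
  obtain ⟨hα, h1, h2⟩ := hα
  refine ⟨⟨?_, ?_⟩, curveIm_pos hn hα⟩
  · have hexp : exp (branchPoint A n α) =
        (Real.exp A * Real.exp (curveRe n α) : ℝ) * exp ((n * Real.pi - α : ℝ) * I) := by
      rw [← Real.exp_add, ofReal_exp, ← exp_add]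
      congr 1
      refine Complex.ext ?_ ?_ <;> simp [branchPoint]
    have hpi : exp (α * I) * exp ((n * Real.pi - α : ℝ) * I) = ((-1) ^ n : ℝ) := by
      rw [← exp_add]
      have : (α : ℂ) * I + (n * Real.pi - α : ℝ) * I = (n : ℂ) * (Real.pi * I) := by
        push_cast; ring
      rw [this, exp_nat_mul, exp_pi_mul_I]
      push_cast; rfl
    have hreal : (n * Real.pi - α) / Real.sin α * (Real.exp A * Real.exp (curveRe n α)) *
        (-1) ^ n = B := by
      have : (n * Real.pi - α) / Real.sin α * (Real.exp A * Real.exp (curveRe n α)) *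
        (-1) ^ n = (-1) ^ n * (curveMod n α * Real.exp A) := by rw [curveMod]; ring
      rw [this, h1, mul_assoc, ← Real.exp_add, neg_add_cancel, Real.exp_zero, mul_one,
        neg_one_pow_mul_abs hB]
    rw [branchPoint_sub A n hα, hexp]
    calc _ = ((n * Real.pi - α) / Real.sin α : ℝ) *
          (Real.exp A * Real.exp (curveRe n α) : ℝ) *
          (exp (α * I) * exp ((n * Real.pi - α : ℝ) * I)) := by ring
      _ = B := by rw [hpi, ← hreal]; push_cast; ring
  · change 0 < A + curveRe n α
    linarith

lemma arg_branchPoint_sub (A : ℝ) {n : ℕ} (hn : 1 ≤ n) {α : ℝ} (hα : α ∈ Set.Ioo 0 Real.pi) :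
    arg (branchPoint A n α - A) = α := by
  rw [branchPoint_sub A n hα, arg_real_mul _ (div_pos (curveIm_pos hn hα) (sin_pos_of_mem hα)),
    arg_exp_mul_I, toIocMod_eq_self]
  exact ⟨by linarith [hα.1, Real.pi_pos], by linarith [hα.2]⟩

lemma arg_mem_Ioo_of_im_pos {u : ℂ} (hu : 0 < u.im) : arg u ∈ Set.Ioo 0 Real.pi := by
  refine ⟨(arg_nonneg_iff.2 hu.le).lt_of_ne fun h => ?_, arg_lt_pi_iff.2 (Or.inr hu.ne')⟩
  exact hu.ne' (arg_eq_zero_iff.1 h.symm).2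

lemma exists_branchPoint_eq {A B : ℝ} {w : ℂ} (hw : w ∈ upperRoots A B) :
    ∃ n ∈ upperIdx A B, ∃ α ∈ rootArgs A B n, branchPoint A n α = w := by
  obtain ⟨⟨hroot, hre⟩, him⟩ := hw
  set u := w - A with hu
  have huim : u.im = w.im := by simp [hu]
  have hure : u.re = w.re - A := by simp [hu]
  have hα := arg_mem_Ioo_of_im_pos (huim ▸ him)
  set α := arg u
  have hu0 : u ≠ 0 := fun h => by rw [h, zero_im] at huim; linarith
  have hpos : 0 < ‖u‖ := norm_pos_iff.2 hu0
  have hcos : ‖u‖ * Real.cos α = u.re := norm_mul_cos_arg u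
  have hsin : ‖u‖ * Real.sin α = u.im := norm_mul_sin_arg u
  have hs := sin_pos_of_mem hα
  have hE : (‖u‖ * Real.exp w.re : ℝ) * exp ((α + w.im : ℝ) * I) = B := by
    rw [← hroot]
    conv_rhs => rw [← norm_mul_exp_arg_mul_I u, ← re_add_im w, exp_add, ← ofReal_exp]
    have : ((α + w.im : ℝ) : ℂ) * I = α * I + w.im * I := by push_cast; ring
    rw [this, exp_add]
    push_cast
    ring
  have hr : 0 < ‖u‖ * Real.exp w.re := mul_pos hpos (Real.exp_pos _)
  have hEre := congrArg re hE
  have hEim := congrArg im hE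
  rw [re_ofReal_mul, exp_ofReal_mul_I_re, ofReal_re] at hEre
  rw [im_ofReal_mul, exp_ofReal_mul_I_im, ofReal_im, mul_eq_zero] at hEim
  -- B is real, so arg u + im w is a multiple kπ; later (-1)^k is identified as the sign of B.
  obtain ⟨k, hk⟩ := Real.sin_eq_zero_iff.1 (hEim.resolve_left hr.ne')
  have hk0 : 0 < k := by
    have : (0 : ℝ) < k := pos_of_mul_pos_left (hk ▸ add_pos hα.1 him) Real.pi_pos.le
    exact_mod_cast this
  obtain ⟨n, rfl⟩ := Int.eq_ofNat_of_zero_le hk0.le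
  have hn : 1 ≤ n := by omega
  rw [Int.cast_natCast] at hk
  rw [← hk, Real.cos_nat_mul_pi] at hEre
  have him' : w.im = n * Real.pi - α := by linarith
  have hsgn : 0 < (-1) ^ n * B := by
    rw [← hEre, mul_left_comm, ← mul_pow]
    simpa using hr
  have hcurve : curveRe n α = u.re := by
    rw [curveRe, ← him', ← huim, ← hsin, ← hcos]
    field_simp
  have hmem : α ∈ rootArgs A B n := by
    refine ⟨hα, ?_, by linarith⟩
    rw [curveMod, hcurve, ← him', ← huim, ← hsin, mul_div_cancel_right₀ _ hs.ne', ← hEre, abs_mul,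
      abs_pow, abs_neg, abs_one, one_pow, mul_one, abs_of_pos hr, mul_assoc, ← Real.exp_add, hure]
    rfl
  refine ⟨n, ⟨hn, hsgn, α, hmem⟩, α, hmem, Complex.ext ?_ ?_⟩
  · change A + curveRe n α = w.re
    linarith
  · exact him'.symm

lemma exists_bijOn_upperRoots (A B : ℝ) :
    ∃ F : ℕ → ℂ, Set.BijOn F (upperIdx A B) (upperRoots A B) := by
  have hch : ∀ n : ℕ, ∃ α : ℝ, n ∈ upperIdx A B → α ∈ rootArgs A B n := fun n => by
    by_cases h : n ∈ upperIdx A B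
    · exact ⟨h.2.2.some, fun _ => h.2.2.some_mem⟩
    · exact ⟨0, fun h' => absurd h' h⟩
  choose α hα using hch
  refine ⟨fun n => branchPoint A n (α n), fun n hn => branchPoint_mem hn.1 hn.2.1 (hα n hn), ?_, ?_⟩
  · intro n hn m hm h
    have harg := congrArg (fun w : ℂ => arg (w - A)) h
    simp only [arg_branchPoint_sub A hn.1 (hα n hn).1,
      arg_branchPoint_sub A hm.1 (hα m hm).1] at harg
    have him : n * Real.pi - α n = m * Real.pi - α m := congrArg im h
    rw [harg, sub_left_inj] at him
    exact_mod_cast mul_right_cancel₀ Real.pi_ne_zero him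
  · intro w hw
    obtain ⟨n, hn, β, hβ, rfl⟩ := exists_branchPoint_eq hw
    refine ⟨n, hn, ?_⟩
    simp only
    rw [rootArgs_subsingleton A B hn.1 (hα n hn) hβ]

lemma conj_mem_scaledRoots {A B : ℝ} {w : ℂ} (hw : w ∈ scaledRoots A B) :
    (starRingEnd ℂ) w ∈ scaledRoots A B := by
  refine ⟨?_, by simpa using hw.2⟩
  have := congrArg (starRingEnd ℂ) hw.1
  simpa [← exp_conj] using this

lemma ofReal_mem_scaledRoots {A B x : ℝ} : (x : ℂ) ∈ scaledRoots A B ↔ x ∈ realRoots A B := by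
  refine and_congr ?_ Iff.rfl
  norm_cast

lemma scaledRoots_eq (A B : ℝ) : scaledRoots A B =
    (fun x : ℝ => (x : ℂ)) '' realRoots A B ∪
      (upperRoots A B ∪ (starRingEnd ℂ) '' upperRoots A B) := by
  ext w
  constructor
  · intro hw
    rcases lt_trichotomy w.im 0 with h | h | h
    · exact Or.inr (Or.inr ⟨(starRingEnd ℂ) w, ⟨conj_mem_scaledRoots hw, by simpa using h⟩, by simp⟩)
    · have hwr : (w.re : ℂ) = w := Complex.ext rfl (by simp [h])
      exact Or.inl ⟨w.re, ofReal_mem_scaledRoots.1 (by rwa [hwr]), hwr⟩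
    · exact Or.inr (Or.inl ⟨hw, h⟩)
  · rintro (⟨x, hx, rfl⟩ | h | ⟨v, hv, rfl⟩)
    · exact ofReal_mem_scaledRoots.2 hx
    · exact h.1
    · exact conj_mem_scaledRoots hv.1

/-- The number of elements of `scaledRoots`, the double root `A - 1` being counted twice. -/
noncomputable def scaledCount (A B : ℝ) : ℕ :=
  ∑ᶠ w ∈ scaledRoots A B, if w = A - 1 then 2 else 1

/-- The number of elements of `realRoots`, the double root `A - 1` being counted twice. -/
noncomputable def realCount (A B : ℝ) : ℕ :=
  ∑ᶠ x ∈ realRoots A B, if x = A - 1 then 2 else 1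

/-- Nonreal roots come in conjugate pairs and are simple, the only possible double root A - 1 being
real. -/
lemma scaledCount_eq {A B : ℝ} (hR : (realRoots A B).Finite) (hN : (upperIdx A B).Finite) :
    (scaledRoots A B).Finite ∧
      scaledCount A B = realCount A B + 2 * (upperIdx A B).ncard := by
  obtain ⟨F, hF⟩ := exists_bijOn_upperRoots A B
  have hPfin : (upperRoots A B).Finite := hF.image_eq ▸ hN.image F
  have hPcard : (upperRoots A B).ncard = (upperIdx A B).ncard := by
    rw [← hF.image_eq, hF.injOn.ncard_image]
  have hRfin := hR.image (fun x : ℝ => (x : ℂ))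
  have hCfin := hPfin.image (starRingEnd ℂ)
  have hone : ∀ s : Set ℂ, s.Finite → (∀ w ∈ s, w.im ≠ 0) →
      (∑ᶠ w ∈ s, if w = A - 1 then 2 else 1) = s.ncard := by
    intro s hfin hs
    rw [finsum_mem_eq_finite_toFinset_sum _ hfin, Set.ncard_eq_toFinset_card s hfin,
      Finset.card_eq_sum_ones]
    refine Finset.sum_congr rfl fun w hw => if_neg fun h => hs w (hfin.mem_toFinset.1 hw) ?_
    simp [h]
  refine ⟨by rw [scaledRoots_eq]; exact hRfin.union (hPfin.union hCfin), ?_⟩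
  have hd1 : Disjoint ((fun x : ℝ => (x : ℂ)) '' realRoots A B)
      (upperRoots A B ∪ (starRingEnd ℂ) '' upperRoots A B) := by
    rw [Set.disjoint_left]
    rintro _ ⟨x, -, rfl⟩ (h | ⟨v, hv, h⟩)
    · simpa using h.2
    · have := congrArg im h
      simp at this
      exact hv.2.ne' this
  have hd2 : Disjoint (upperRoots A B) ((starRingEnd ℂ) '' upperRoots A B) := by
    rw [Set.disjoint_left]
    rintro w hw ⟨v, hv, h⟩
    have := congrArg im h
    rw [conj_im] at this
    linarith [hv.2, hw.2]
  rw [scaledCount, scaledRoots_eq, finsum_mem_union hd1 hRfin (hPfin.union hCfin),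
    finsum_mem_union hd2 hPfin hCfin, finsum_mem_image ofReal_injective.injOn,
    hone _ hPfin fun w hw => hw.2.ne', hone _ hCfin ?_,
    Set.ncard_image_of_injective _ (starRingEnd ℂ).injective, hPcard, ← two_mul, realCount]
  · congr 1
    refine finsum_mem_congr rfl fun x _ => if_congr ?_ rfl rfl
    norm_cast
  · rintro _ ⟨v, hv, rfl⟩
    simpa using hv.2.ne'

lemma bijOn_mul_unstableRoots (hτ : 0 < τ) :
    Set.BijOn (fun z : ℂ => z * τ) (unstableRoots a b τ) (scaledRoots (a * τ) (b * τ)) := by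
  have hτ' : (τ : ℂ) ≠ 0 := ofReal_ne_zero.2 hτ.ne'
  have key : ∀ z : ℂ, charFn a b τ z = 0 ↔
      (z * τ - (a * τ : ℝ)) * exp (z * τ) = (b * τ : ℝ) := by
    intro z
    have h1 : exp (-z * τ) * exp (z * τ) = 1 := by rw [← exp_add]; simp
    have h2 : (z * τ - (a * τ : ℝ)) * exp (z * τ) - (b * τ : ℝ) =
        charFn a b τ z * (τ * exp (z * τ)) := by
      rw [charFn]
      push_cast
      linear_combination (-(b : ℂ) * τ) * (-h1)
    rw [← sub_eq_zero (b := ((b * τ : ℝ) : ℂ)), h2, mul_eq_zero]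
    simp [hτ', exp_ne_zero]
  refine ⟨fun z hz => ⟨(key z).1 hz.1, ?_⟩, fun z _ w _ h => mul_right_cancel₀ hτ' h, ?_⟩
  · simpa using mul_pos hz.2 hτ
  · intro w hw
    refine ⟨w / τ, ⟨(key _).2 ?_, ?_⟩, div_mul_cancel₀ _ hτ'⟩
    · rw [div_mul_cancel₀ _ hτ']; exact hw.1
    · rw [div_ofReal_re]; exact div_pos hw.2 hτ

/-- At a root b e^{-zτ} = z - a, so χ'(z) = 1 + τ (z - a). -/
lemma analyticOrderNatAt_charFn_eq {z : ℂ} (hz : z ∈ unstableRoots a b τ) : analyticOrderNatAt (charFn a b τ) z =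
      if z * τ = (a * τ : ℝ) - 1 then 2 else 1 := by
  rw [analyticOrderNatAt, analyticOrderAt_charFn hz.1, ENat.toNat_natCast]
  refine if_congr ?_ rfl rfl
  have h := hz.1
  rw [charFn] at h
  rw [← sub_eq_zero (a := z * τ)]
  push_cast
  have : 1 + (b : ℂ) * τ * exp (-z * τ) = z * τ - (a * τ - 1) := by
    linear_combination (-(τ : ℂ)) * h
  rw [this]

lemma numUnstableRoots_eq (hτ : 0 < τ) (hfin : (scaledRoots (a * τ) (b * τ)).Finite) :
    (unstableRoots a b τ).Finite ∧
      numUnstableRoots a b τ = scaledCount (a * τ) (b * τ) := by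
  have hbij := bijOn_mul_unstableRoots (a := a) (b := b) hτ
  refine ⟨hbij.finite_iff_finite.2 hfin, ?_⟩
  exact finsum_mem_eq_of_bijOn _ hbij fun z hz => analyticOrderNatAt_charFn_eq hz

/-! ### Positive real roots -/

lemma hasDerivAt_sub_mul_exp (A x : ℝ) :
    HasDerivAt (fun x : ℝ => (x - A) * Real.exp x) ((x - (A - 1)) * Real.exp x) x :=
  (((hasDerivAt_id x).sub_const A).mul (Real.hasDerivAt_exp x)).congr_deriv (by simp only [id]; ring)

lemma continuous_sub_mul_exp (A : ℝ) : Continuous fun x : ℝ => (x - A) * Real.exp x := by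
  fun_prop

lemma strictMonoOn_sub_mul_exp (A : ℝ) :
    StrictMonoOn (fun x : ℝ => (x - A) * Real.exp x) (Set.Ici (A - 1)) := by
  refine strictMonoOn_of_deriv_pos (convex_Ici _) (continuous_sub_mul_exp A).continuousOn
    fun x hx => ?_
  rw [interior_Ici] at hx
  rw [(hasDerivAt_sub_mul_exp A x).deriv]
  exact mul_pos (sub_pos.2 hx) (Real.exp_pos _)

lemma strictAntiOn_sub_mul_exp (A : ℝ) :
    StrictAntiOn (fun x : ℝ => (x - A) * Real.exp x) (Set.Iic (A - 1)) := by
  refine strictAntiOn_of_deriv_neg (convex_Iic _) (continuous_sub_mul_exp A).continuousOn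
    fun x hx => ?_
  rw [interior_Iic] at hx
  rw [(hasDerivAt_sub_mul_exp A x).deriv]
  exact mul_neg_of_neg_of_pos (sub_neg.2 hx) (Real.exp_pos _)

lemma exists_root_gt (A B : ℝ) {y : ℝ} (hy0 : 0 ≤ y) (hy : (y - A) * Real.exp y < B) :
    ∃ x, y < x ∧ (x - A) * Real.exp x = B := by
  set T := y + |A| + |B|
  have hyT : y ≤ T := by
    simp only [T]
    linarith [abs_nonneg A, abs_nonneg B]
  have hT : B ≤ (T - A) * Real.exp T := by
    have h1 : |B| ≤ T - A := by simp only [T]; linarith [le_abs_self A]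
    have h2 : 1 ≤ Real.exp T := Real.one_le_exp (hy0.trans hyT)
    nlinarith [le_abs_self B, abs_nonneg B]
  obtain ⟨x, hx, hxB⟩ := intermediate_value_Icc hyT (continuous_sub_mul_exp A).continuousOn
    ⟨hy.le, hT⟩
  refine ⟨x, hx.1.lt_of_ne ?_, hxB⟩
  rintro rfl
  exact hy.ne hxB

/-- The function decreases on (-∞, A - 1] and starts from -A < B at 0, so a positive root can only
lie on the increasing part. -/
lemma realRoots_of_neg_lt {A B : ℝ} (h : -A < B) :
    (realRoots A B).Finite ∧ realCount A B = 1 := by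
  obtain ⟨x, hx0, hx⟩ := exists_root_gt A B le_rfl (by simpa using h)
  have hgt : ∀ y ∈ realRoots A B, A - 1 < y := by
    rintro y ⟨hy, hy0⟩
    by_contra! hle
    have := strictAntiOn_sub_mul_exp A (Set.mem_Iic.2 (hy0.le.trans hle)) (Set.mem_Iic.2 hle) hy0
    simp only [zero_sub, Real.exp_zero, mul_one] at this
    linarith
  have heq : realRoots A B = {x} := by
    refine Set.eq_singleton_iff_unique_mem.2 ⟨⟨hx, hx0⟩, fun y hy => ?_⟩
    exact (strictMonoOn_sub_mul_exp A).injOn (hgt y hy).le (hgt x ⟨hx, hx0⟩).le (hy.1.trans hx.symm)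
  refine ⟨heq ▸ Set.finite_singleton x, ?_⟩
  rw [realCount, heq, finsum_mem_singleton, if_neg (hgt x ⟨hx, hx0⟩).ne']

lemma neg_exp_le_sub_mul_exp (A x : ℝ) : -Real.exp (A - 1) ≤ (x - A) * Real.exp x := by
  have h : (A - 1 - A) * Real.exp (A - 1) = -Real.exp (A - 1) := by ring
  rw [← h]
  rcases le_total x (A - 1) with hx | hx
  · exact (strictAntiOn_sub_mul_exp A).antitoneOn hx (Set.mem_Iic.2 le_rfl) hx
  · exact (strictMonoOn_sub_mul_exp A).monotoneOn (Set.mem_Ici.2 le_rfl) hx hx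

lemma realRoots_of_lt_neg {A B : ℝ} (h : B < -A) (h' : 1 ≤ A → B < -Real.exp (A - 1)) :
    (realRoots A B).Finite ∧ realCount A B = 0 := by
  have heq : realRoots A B = ∅ := by
    refine Set.eq_empty_iff_forall_notMem.2 ?_
    rintro x ⟨hx, hx0⟩
    rcases le_or_gt 1 A with hA | hA
    · linarith [h' hA, neg_exp_le_sub_mul_exp A x]
    · have := strictMonoOn_sub_mul_exp A (Set.mem_Ici.2 (by linarith : A - 1 ≤ 0))
        (Set.mem_Ici.2 (by linarith : A - 1 ≤ x)) hx0
      simp only [zero_sub, Real.exp_zero, mul_one] at this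
      linarith
  exact ⟨heq ▸ Set.finite_empty, by rw [realCount, heq, finsum_mem_empty]⟩

lemma realRoots_of_neg_exp_le {A B : ℝ} (h : B < -A) (hA : 1 ≤ A) (h' : -Real.exp (A - 1) ≤ B) :
    (realRoots A B).Finite ∧ realCount A B = 2 := by
  have hmin : (A - 1 - A) * Real.exp (A - 1) = -Real.exp (A - 1) := by ring
  -- For A = 1 the two bounds on B would read -1 ≤ B < -1.
  have hA1 : 0 < A - 1 := by
    refine sub_pos.2 (hA.lt_of_ne ?_)
    rintro rfl
    rw [sub_self, Real.exp_zero] at h'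
    linarith
  rcases h'.eq_or_lt with h' | h'
  · have heq : realRoots A B = {A - 1} := by
      refine Set.eq_singleton_iff_unique_mem.2 ⟨⟨by rw [hmin, h'], hA1⟩, fun x hx => ?_⟩
      have hx' : (x - A) * Real.exp x = (A - 1 - A) * Real.exp (A - 1) := by rw [hx.1, hmin, h']
      rcases le_total x (A - 1) with h | h
      · exact (strictAntiOn_sub_mul_exp A).injOn h (Set.mem_Iic.2 le_rfl) hx'
      · exact (strictMonoOn_sub_mul_exp A).injOn h (Set.mem_Ici.2 le_rfl) hx'
    refine ⟨heq ▸ Set.finite_singleton _, ?_⟩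
    rw [realCount, heq, finsum_mem_singleton, if_pos rfl]
  · obtain ⟨x₂, hx₂, e₂⟩ := exists_root_gt A B hA1.le (by rwa [hmin])
    obtain ⟨x₁, hx₁, e₁⟩ := intermediate_value_Ioo' hA1.le
      (continuous_sub_mul_exp A).continuousOn (show B ∈ Set.Ioo _ _ from
        ⟨by simpa only [hmin], by simpa using h⟩)
    have heq : realRoots A B = {x₁, x₂} := by
      refine Set.Subset.antisymm (fun x hx => ?_) ?_
      · rcases le_total x (A - 1) with h | h
        · exact Or.inl ((strictAntiOn_sub_mul_exp A).injOn h hx₁.2.le (hx.1.trans e₁.symm))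
        · exact Or.inr ((strictMonoOn_sub_mul_exp A).injOn h hx₂.le (hx.1.trans e₂.symm))
      · rintro _ (rfl | rfl)
        · exact ⟨e₁, hx₁.1⟩
        · exact ⟨e₂, hA1.trans hx₂⟩
    refine ⟨heq ▸ Set.toFinite _, ?_⟩
    rw [realCount, heq, finsum_mem_pair (hx₁.2.trans hx₂).ne, if_neg hx₁.2.ne, if_neg hx₂.ne']

/-! ### Counting the crossed branches -/

/-- The crossing phase belonging to the sign of `B`. -/
noncomputable def crossingPhase (B θ : ℝ) : ℝ :=
  if 0 < B then 2 * Real.pi - θ else Real.pi - θ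

/-- The branches of the right parity that have crossed the imaginary axis. -/
def crossedIdx (B Ω θ : ℝ) : Set ℕ :=
  {n : ℕ | 1 ≤ n ∧ 0 < (-1) ^ n * B ∧ n * Real.pi < Ω + θ}

lemma neg_one_pow_mul_pos_iff {B : ℝ} (hB : B ≠ 0) (n : ℕ) :
    0 < (-1) ^ n * B ↔ (Even n ↔ 0 < B) := by
  rcases Nat.even_or_odd n with h | h
  · simp [h, h.neg_one_pow]
  · rw [h.neg_one_pow, ← Nat.not_even_iff_odd] at *
    simp only [h, false_iff, not_lt]
    constructor
    · intro h; linarith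
    · intro h; linarith [lt_of_le_of_ne h hB]

/-- The sign of B selects n = 2j + 2 or n = 2j + 1, and nπ < Ω + θ becomes 2πj < Ω minus the
crossing phase. -/
lemma crossedIdx_eq {B Ω θ : ℝ} (hB : B ≠ 0) :
    crossedIdx B Ω θ = (fun j : ℕ => if 0 < B then 2 * j + 2 else 2 * j + 1) ''
      (Finset.range ⌈1 / (2 * Real.pi) * (Ω - crossingPhase B θ)⌉₊ : Set ℕ) := by
  have hlt : ∀ j : ℕ, j ∈ (Finset.range ⌈1 / (2 * Real.pi) * (Ω - crossingPhase B θ)⌉₊ : Set ℕ) ↔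
      j * (2 * Real.pi) < Ω - crossingPhase B θ := by
    intro j
    rw [Finset.coe_range, Set.mem_Iio, Nat.lt_ceil, one_div_mul_eq_div, lt_div_iff₀ Real.two_pi_pos]
  ext n
  simp only [Set.mem_image, hlt]
  simp only [crossedIdx, Set.mem_ofPred_eq, neg_one_pow_mul_pos_iff hB,
    crossingPhase]
  constructor
  · rintro ⟨h1, h2, h3⟩
    split_ifs with h
    · obtain ⟨k, rfl⟩ := h2.2 h
      obtain ⟨j, rfl⟩ : ∃ j, k = j + 1 := ⟨k - 1, by omega⟩
      refine ⟨j, ?_, by ring⟩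
      push_cast at h3
      linarith
    · obtain ⟨j, rfl⟩ := Nat.not_even_iff_odd.1 fun he => h (h2.1 he)
      refine ⟨j, ?_, rfl⟩
      push_cast at h3
      linarith
  · rintro ⟨j, hj, rfl⟩
    split_ifs at hj ⊢ with h
    · refine ⟨by omega, iff_of_true ⟨j + 1, by ring⟩ h, ?_⟩
      push_cast
      linarith
    · refine ⟨by omega, iff_of_false (Nat.not_even_iff_odd.2 ⟨j, rfl⟩) h, ?_⟩
      push_cast
      linarith

lemma ncard_crossedIdx {B Ω θ : ℝ} (hB : B ≠ 0) :
    (crossedIdx B Ω θ).Finite ∧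
      (crossedIdx B Ω θ).ncard = ⌈1 / (2 * Real.pi) * (Ω - crossingPhase B θ)⌉₊ := by
  rw [crossedIdx_eq hB]
  refine ⟨(Finset.finite_toSet _).image _, ?_⟩
  rw [Set.ncard_image_of_injective, Set.ncard_coe_finset, Finset.card_range]
  intro i j hij
  simp only at hij
  split_ifs at hij <;> omega

/-- The number of unstable roots when `|A| < |B|`, in the polar coordinates
`-A + i Ω = |B| e^{iθ}`. -/
lemma scaledCount_of_abs_lt {A B Ω θ : ℝ} (hAB : |A| < |B|)
    (hθ : θ ∈ Set.Ioo 0 Real.pi) (hcos : -A = |B| * Real.cos θ) (hsin : Ω = |B| * Real.sin θ) :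
    (scaledRoots A B).Finite ∧ scaledCount A B =
      2 * ⌈1 / (2 * Real.pi) * (Ω - crossingPhase B θ)⌉₊ + if 0 < A + B then 1 else 0 := by
  have hB : B ≠ 0 := abs_pos.1 ((abs_nonneg A).trans_lt hAB)
  obtain ⟨hMfin, hMcard⟩ := ncard_crossedIdx (Ω := Ω) (θ := θ) hB
  -- The exceptional case: branch 1 counts as crossed but carries no root, and two positive real
  -- roots, counted with multiplicity, make up for the missing pair.
  by_cases he : B < 0 ∧ 1 ≤ A ∧ -Real.exp (A - 1) ≤ B
  · obtain ⟨hB0, hA, hle⟩ := he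
    have hBA : B < -A := by
      rw [abs_of_neg hB0, abs_of_pos (a := A) (by linarith)] at hAB
      linarith
    obtain ⟨hRfin, hR⟩ := realRoots_of_neg_exp_le hBA hA hle
    have h1 : 1 ∈ crossedIdx B Ω θ :=
      ⟨le_rfl, by linarith, by simpa using pi_lt_add_of_one_le hA hθ hcos hsin⟩
    have hidx : upperIdx A B = crossedIdx B Ω θ \ {1} := by
      ext n
      rw [Set.mem_sdiff, Set.mem_singleton_iff]
      constructor
      · rintro ⟨hn, hs, hne⟩
        have hn1 : n ≠ 1 := by
          rintro rfl
          rw [rootArgs_one_nonempty_iff hA, abs_of_neg hB0] at hne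
          linarith
        exact ⟨⟨hn, hs, (rootArgs_nonempty_iff_lt hn hB hθ hcos hsin
          (Or.inl (by omega))).1 hne⟩, hn1⟩
      · rintro ⟨⟨hn, hs, hlt⟩, hn1⟩
        exact ⟨hn, hs, (rootArgs_nonempty_iff_lt hn hB hθ hcos hsin (Or.inl (by omega))).2 hlt⟩
    have hcard := Set.ncard_sdiff_singleton_add_one h1 hMfin
    obtain ⟨hfin, hcount⟩ := scaledCount_eq hRfin (hidx ▸ hMfin.sdiff)
    refine ⟨hfin, ?_⟩
    rw [hcount, hR, if_neg (by linarith), ← hMcard, hidx]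
    omega
  · have hidx : upperIdx A B = crossedIdx B Ω θ := by
      ext n
      refine and_congr_right fun hn => and_congr_right fun hs => ?_
      by_cases hc : 2 ≤ n ∨ A < 1
      · exact rootArgs_nonempty_iff_lt hn hB hθ hcos hsin hc
      · push Not at hc
        obtain rfl : n = 1 := by omega
        have hB0 : B < 0 := by linarith
        refine iff_of_true ?_ (by simpa using pi_lt_add_of_one_le hc.2 hθ hcos hsin)
        rw [rootArgs_one_nonempty_iff hc.2, abs_of_neg hB0]
        by_contra! h
        exact he ⟨hB0, hc.2, by linarith⟩
    have hR : (realRoots A B).Finite ∧ realCount A B = if 0 < A + B then 1 else 0 := by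
      split_ifs with h
      · exact realRoots_of_neg_lt (by linarith)
      · have hne : A + B ≠ 0 := fun h0 => by
          rw [eq_neg_of_add_eq_zero_left h0, abs_neg] at hAB
          exact lt_irrefl _ hAB
        have hlt : A + B < 0 := lt_of_le_of_ne (not_lt.1 h) hne
        have hB0 : B < 0 := by
          by_contra! h0
          rw [abs_of_nonneg h0] at hAB
          linarith [neg_abs_le A]
        refine realRoots_of_lt_neg (by linarith) fun hA => ?_
        by_contra! hle
        exact he ⟨hB0, hA, hle⟩
    obtain ⟨hfin, hcount⟩ := scaledCount_eq hR.1 (hidx ▸ hMfin)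
    refine ⟨hfin, ?_⟩
    rw [hcount, hR.2, hidx, hMcard, add_comm]

lemma scaledCount_of_lt_abs {A B : ℝ} (hAB : |B| < |A|) :
    (scaledRoots A B).Finite ∧ scaledCount A B = if 0 < A + B then 1 else 0 := by
  have hidx : upperIdx A B = ∅ :=
    Set.eq_empty_iff_forall_notMem.2 fun n hn => rootArgs_eq_empty hAB hn.1 hn.2.2
  have hR : (realRoots A B).Finite ∧ realCount A B = if 0 < A + B then 1 else 0 := by
    split_ifs with h
    · exact realRoots_of_neg_lt (by linarith)
    · have hA : A < 0 := by
        by_contra! h0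
        rw [abs_of_nonneg h0] at hAB
        linarith [neg_abs_le B]
      rw [abs_of_neg hA] at hAB
      exact realRoots_of_lt_neg (by linarith [le_abs_self B]) fun h1 => by linarith
  obtain ⟨hfin, hcount⟩ := scaledCount_eq hR.1 (hidx ▸ Set.finite_empty)
  refine ⟨hfin, ?_⟩
  rw [hcount, hR.2, hidx, Set.ncard_empty, mul_zero, add_zero]

/-! ### Zero delay, the phase φ_H and return to the original variables -/

lemma numUnstableRoots_zero_delay (a b : ℝ) :
    (unstableRoots a b 0).Finite ∧ numUnstableRoots a b 0 = nu a b := by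
  have hiff : ∀ z : ℂ, z ∈ unstableRoots a b 0 ↔ z = ((a + b : ℝ) : ℂ) ∧ 0 < a + b := by
    intro z
    have h0 : charFn a b 0 z = 0 ↔ z = ((a + b : ℝ) : ℂ) := by
      simp [charFn, sub_sub, sub_eq_zero]
    constructor
    · rintro ⟨h1, h2⟩
      have h := h0.1 h1
      rw [h, ofReal_re] at h2
      exact ⟨h, h2⟩
    · rintro ⟨h1, h2⟩
      refine ⟨h0.2 h1, ?_⟩
      rwa [h1, ofReal_re]
  by_cases h : 0 < a + b
  · have heq : unstableRoots a b 0 = {((a + b : ℝ) : ℂ)} := by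
      ext z
      rw [hiff, and_iff_left h, Set.mem_singleton_iff]
    refine ⟨heq ▸ Set.finite_singleton _, ?_⟩
    have hmem := ((hiff ((a + b : ℝ) : ℂ)).2 ⟨rfl, h⟩).1
    rw [numUnstableRoots, heq, finsum_mem_singleton, analyticOrderNatAt,
      analyticOrderAt_charFn hmem, nu, if_pos h]
    simp
  · have heq : unstableRoots a b 0 = ∅ :=
      Set.eq_empty_iff_forall_notMem.2 fun z hz => h ((hiff z).1 hz).2
    refine ⟨heq ▸ Set.finite_empty, ?_⟩
    rw [numUnstableRoots, heq, finsum_mem_empty, nu, if_neg h]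

lemma minPosArg_exp_mul_I {φ : ℝ} (h0 : 0 < φ) (h1 : φ ≤ 2 * Real.pi) :
    minPosArg (exp (φ * I)) = φ := by
  rw [minPosArg, arg_exp_mul_I, toIocMod_eq_iff]
  refine ⟨⟨h0, by simpa using h1⟩, -toIocDiv Real.two_pi_pos (-Real.pi) φ, ?_⟩
  rw [toIocMod, neg_smul]
  ring

/-- Polar coordinates `-a + i ω_H = |b| e^{iθ}` and the phase `φ_H`. -/
lemma exists_polar (h : |a| < |b|) : ∃ θ ∈ Set.Ioo 0 Real.pi, -a = |b| * Real.cos θ ∧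
    omegaH a b = |b| * Real.sin θ ∧ phiH a b = crossingPhase b θ := by
  have hsq : 0 < b ^ 2 - a ^ 2 := sub_pos.2 (sq_lt_sq.2 h)
  have hω : 0 < omegaH a b := Real.sqrt_pos.2 hsq
  have hω2 : omegaH a b ^ 2 = b ^ 2 - a ^ 2 := Real.sq_sqrt hsq.le
  have hb : b ≠ 0 := abs_pos.1 ((abs_nonneg a).trans_lt h)
  set u : ℂ := ⟨-a, omegaH a b⟩
  have hu : ‖u‖ = |b| := by
    rw [norm_eq_sqrt_sq_add_sq, ← Real.sqrt_sq_eq_abs]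
    congr 1
    change (-a) ^ 2 + omegaH a b ^ 2 = b ^ 2
    linarith
  have hcos : |b| * Real.cos (arg u) = -a := hu ▸ norm_mul_cos_arg u
  have hsin : |b| * Real.sin (arg u) = omegaH a b := hu ▸ norm_mul_sin_arg u
  have hθ : arg u ∈ Set.Ioo 0 Real.pi := arg_mem_Ioo_of_im_pos hω
  refine ⟨arg u, hθ, hcos.symm, hsin.symm, ?_⟩
  set θ := arg u
  -- The conjugate of Y(ω_H) is sgn(b) e^{-iθ}; a negative sign shifts the phase 2π - θ to π - θ.
  have key : (starRingEnd ℂ) (genRoot a b (omegaH a b)) = exp (crossingPhase b θ * I) := by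
    have hb' : (b : ℂ) ≠ 0 := ofReal_ne_zero.2 hb
    have hL : (starRingEnd ℂ) (genRoot a b (omegaH a b)) =
        ((-a / b : ℝ) : ℂ) + ((-omegaH a b / b : ℝ) : ℂ) * I := by
      rw [genRoot, map_div₀, map_sub, map_mul, conj_I, conj_ofReal, conj_ofReal, conj_ofReal]
      push_cast
      ring
    rw [hL, exp_mul_I, ← ofReal_cos, ← ofReal_sin, ← hcos, ← hsin, crossingPhase]
    rcases hb.lt_or_gt with hneg | hpos
    · rw [if_neg hneg.not_gt, Real.cos_pi_sub, Real.sin_pi_sub, abs_of_neg hneg]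
      congr 3
      · field_simp
      · field_simp
    · rw [if_pos hpos, Real.cos_two_pi_sub, Real.sin_two_pi_sub, abs_of_pos hpos]
      congr 3
      · field_simp
      · field_simp
  rw [phiH, key, minPosArg_exp_mul_I]
  · rw [crossingPhase]; split_ifs <;> linarith [hθ.1, hθ.2]
  · rw [crossingPhase]; split_ifs <;> linarith [hθ.1, hθ.2, Real.pi_pos]

lemma conj_genRoot_eq (h : |a| < |b|) : -((a / b : ℝ) : ℂ) -
    I * ((Real.sign b * √(1 - (a / b) ^ 2) : ℝ) : ℂ) =
      (starRingEnd ℂ) (genRoot a b (omegaH a b)) := by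
  have hb : b ≠ 0 := abs_pos.1 ((abs_nonneg a).trans_lt h)
  have hsqrt : Real.sign b * √(1 - (a / b) ^ 2) = omegaH a b / b := by
    have h1 : 1 - (a / b) ^ 2 = (b ^ 2 - a ^ 2) / b ^ 2 := by field_simp
    rw [h1, Real.sqrt_div' _ (sq_nonneg b), Real.sqrt_sq_eq_abs, omegaH]
    rcases hb.lt_or_gt with hneg | hpos
    · rw [Real.sign_of_neg hneg, abs_of_neg hneg]; field_simp
    · rw [Real.sign_of_pos hpos, abs_of_pos hpos, one_mul]
  rw [hsqrt, genRoot, map_div₀, map_sub, map_mul, conj_I, conj_ofReal, conj_ofReal, conj_ofReal]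
  push_cast
  ring

/-- As φ < 2π the argument exceeds -1, so the integer ceiling is never negative. -/
lemma natCast_ceil_crossing {x φ : ℝ} (hx : 0 ≤ x) (hφ : φ < 2 * Real.pi) :
    ((⌈1 / (2 * Real.pi) * (x - φ)⌉₊ : ℕ) : ℤ) = ⌈1 / (2 * Real.pi) * (x - φ)⌉ := by
  refine Int.natCast_ceil_eq_ceil_of_neg_one_lt ?_
  rw [one_div_mul_eq_div, lt_div_iff₀ Real.two_pi_pos]
  linarith

lemma numUnstableRoots_of_abs_lt (hτ : 0 ≤ τ) (h : |a| < |b|) :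
    (unstableRoots a b τ).Finite ∧ (numUnstableRoots a b τ : ℤ) =
      2 * ⌈1 / (2 * Real.pi) * (τ * omegaH a b - phiH a b)⌉ + nu a b := by
  obtain ⟨θ, hθ, hcos, hsin, hφ⟩ := exists_polar h
  have hφ0 : 0 < phiH a b := by
    rw [hφ, crossingPhase]; split_ifs <;> linarith [hθ.1, hθ.2]
  have hφ1 : phiH a b < 2 * Real.pi := by
    rw [hφ, crossingPhase]; split_ifs <;> linarith [hθ.1, hθ.2, Real.pi_pos]
  have hω : 0 ≤ τ * omegaH a b := mul_nonneg hτ (Real.sqrt_nonneg _)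
  rw [← natCast_ceil_crossing hω hφ1]
  rcases hτ.eq_or_lt with rfl | hτ
  · obtain ⟨hfin, hnum⟩ := numUnstableRoots_zero_delay a b
    have h0 : ⌈1 / (2 * Real.pi) * (0 * omegaH a b - phiH a b)⌉₊ = 0 := by
      refine Nat.ceil_eq_zero.2 (mul_nonpos_of_nonneg_of_nonpos ?_ ?_)
      · positivity
      · linarith
    refine ⟨hfin, ?_⟩
    rw [hnum, h0]
    simp
  · have habs : ∀ x : ℝ, |x * τ| = |x| * τ := fun x => by rw [abs_mul, abs_of_pos hτ]
    obtain ⟨hfin, hcount⟩ := scaledCount_of_abs_lt (A := a * τ) (B := b * τ) (θ := θ)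
      (Ω := τ * omegaH a b) (by rw [habs, habs]; gcongr) hθ
      (by rw [habs]; linear_combination τ * hcos) (by rw [habs, hsin]; ring)
    obtain ⟨hfin', hnum⟩ := numUnstableRoots_eq hτ hfin
    refine ⟨hfin', ?_⟩
    have hphase : crossingPhase (b * τ) θ = phiH a b := by
      rw [hφ, crossingPhase, crossingPhase]
      exact if_congr (mul_pos_iff_of_pos_right hτ) rfl rfl
    have hnu : (if 0 < a * τ + b * τ then 1 else 0) = nu a b := by
      rw [nu, ← add_mul]
      exact if_congr (mul_pos_iff_of_pos_right hτ) rfl rfl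
    rw [hnum, hcount, hphase, hnu]
    push_cast
    rfl

lemma numUnstableRoots_of_lt_abs (hτ : 0 ≤ τ) (h : |b| < |a|) :
    (unstableRoots a b τ).Finite ∧ numUnstableRoots a b τ = nu a b := by
  rcases hτ.eq_or_lt with rfl | hτ
  · exact numUnstableRoots_zero_delay a b
  · obtain ⟨hfin, hcount⟩ := scaledCount_of_lt_abs (A := a * τ) (B := b * τ) (by
      rw [abs_mul, abs_mul, abs_of_pos hτ]; gcongr)
    obtain ⟨hfin', hnum⟩ := numUnstableRoots_eq hτ hfin
    refine ⟨hfin', ?_⟩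
    rw [hnum, hcount, nu, ← add_mul]
    exact if_congr (mul_pos_iff_of_pos_right hτ) rfl rfl

end ScalarDDE

theorem mainTheorem4 (a b τ : ℝ) (hτ : 0 ≤ τ) :
    (|a| < |b| →
      FiniteDimensional ℝ (ScalarDDE.unstableManifold a b τ) ∧
      (ScalarDDE.unstableRoots a b τ).Finite ∧
      Module.finrank ℝ (ScalarDDE.unstableManifold a b τ) = ScalarDDE.numUnstableRoots a b τ ∧
      (Module.finrank ℝ (ScalarDDE.unstableManifold a b τ) : ℤ) =
        2 * ⌈1 / (2 * Real.pi) * (τ * ScalarDDE.omegaH a b - ScalarDDE.phiH a b)⌉ +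
          ScalarDDE.nu a b ∧
      (Module.finrank ℝ (ScalarDDE.unstableManifold a b τ) : ℤ) =
        2 * ⌈1 / (2 * Real.pi) * (τ * √(b ^ 2 - a ^ 2) -
          minPosArg (-((a / b : ℝ) : ℂ) -
            Complex.I * ((Real.sign b * √(1 - (a / b) ^ 2) : ℝ) : ℂ)))⌉ +
          ScalarDDE.nu a b) ∧
    (|b| < |a| →
      FiniteDimensional ℝ (ScalarDDE.unstableManifold a b τ) ∧
      (ScalarDDE.unstableRoots a b τ).Finite ∧
      Module.finrank ℝ (ScalarDDE.unstableManifold a b τ) = ScalarDDE.numUnstableRoots a b τ ∧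
      Module.finrank ℝ (ScalarDDE.unstableManifold a b τ) = ScalarDDE.nu a b) := by
  refine ⟨fun h => ?_, fun h => ?_⟩
  · obtain ⟨hfin, hnum⟩ := ScalarDDE.numUnstableRoots_of_abs_lt hτ h
    obtain ⟨hfd, hrank⟩ := ScalarDDE.finrank_unstableManifold hτ hfin
    refine ⟨hfd, hfin, hrank, by rw [hrank, hnum], ?_⟩
    rw [ScalarDDE.conj_genRoot_eq h, hrank, hnum]
    rfl
  · obtain ⟨hfin, hnum⟩ := ScalarDDE.numUnstableRoots_of_lt_abs hτ h
    obtain ⟨hfd, hrank⟩ := ScalarDDE.finrank_unstableManifold hτ hfin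
    exact ⟨hfd, hfin, hrank, hrank.trans hnum⟩
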